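/- Let $(X_i)_{i\in\mathbb Z}$ be a real stationary sequence with a filtration $(\mathcal F_i)_{i\in\mathbb Z}$ on a probability space $(\Omega,\mathcal F,\mathbb P)$, given in one of the following two ways. (a) $T:\Omega\to\Omega$ is bijective, bimeasurable and preserves $\mathbb P$; $\mathcal F_0\subseteq\mathcal F$ is a $\sigma$-algebra with $\mathcal F_0\subseteq T^{-1}(\mathcal F_0)$; $\mathcal F_i=T^{-i}(\mathcal F_0)$ and $X_i=X_0\circ T^i$, where $X_0$ is $\mathcal F_0$-measurable with $\mathbb E(X_0)=0$ and $\mathbb E(X_0^2)<\infty$. (b) $(\xi_i)_{i\in\mathbb Z}$ is a (strictly) stationary Markov chain with values in a measurable space and marginal law $\pi$; $\mathcal F_i=\sigma(\xi_j:j\le i)$ and $X_i=f(\xi_i)$, where $\int f^2\,d\pi<\infty$ and $\int f\,d\pi=0$. Put $S_n=\sum_{i=0}^{n-1}X_i$ and let $\|\cdot\|$ be the norm of $L^2(\mathbb P)$. Let $(b_n)_{n\ge1}$ be a sequence of positive numbers that is nondecreasing, slowly varying (that is, $b_{\lfloor\lambda n\rfloor}/b_n\to1$ as $n\to\infty$ for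 every $\lambda>0$) and satisfies $\sum_{n\ge1}(nb_n)^{-1}<\infty$, and suppose that $$\sum_{n\ge1}\frac{b_n}{n}\Big(\sum_{k\ge n}\frac{\|\mathbb E(S_k\mid\mathcal F_0)\|}{k^{3/2}}\Big)^2<\infty .$$ Then there is a stationary sequence $(D_k)_{k\in\mathbb Z}$ of square integrable martingale differences, with $D_k$ $\mathcal F_{k+1}$-measurable and $\mathbb E(D_k\mid\mathcal F_k)=0$ a.s. for all $k\in\mathbb Z$ (and $D_k=D_0\circ T^k$ in case (a)), such that the martingale $M_n=\sum_{i=0}^{n-1}D_i$, $n\ge 0$, with respect to $(\mathcal F_n)_{n\ge0}$, satisfies $$\frac{S_n-M_n}{\sqrt n}\to0\quad\text{a.s.}$$ For every $\gamma>1$ the sequence $b_n=(\log n)(\log\log n)^\gamma$, $n\ge3$, continued by $b_1=b_2=b_3$, has the properties required of $(b_n)$. -/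

import Mathlib

open MeasureTheory ProbabilityTheory Filter Topology
open scoped ENNReal

namespace MartApprox

/-! ### Sequences of weights -/

/-- A (positive) sequence is slowly varying if `b ⌊l n⌋ / b n → 1` for every `l > 0`. -/
def SlowlyVarying (b : ℕ → ℝ) : Prop :=
  ∀ l : ℝ, 0 < l → Tendsto (fun n : ℕ => b ⌊l * (n : ℝ)⌋₊ / b n) atTop (𝓝 1)

/-- Requirements on the weights `(b_n)_{n ≥ 1}`: positive, nondecreasing, slowly varying, and
`∑_{n ≥ 1} (n b_n)⁻¹ < ∞`. The value `b 0` plays no role. -/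
structure AdmissibleWeights (b : ℕ → ℝ) : Prop where
  pos : ∀ n : ℕ, 1 ≤ n → 0 < b n
  nondecreasing : ∀ m n : ℕ, 1 ≤ m → m ≤ n → b m ≤ b n
  slowlyVarying : SlowlyVarying b
  summable : Summable (fun n : ℕ => (((n + 1 : ℕ) : ℝ) * b (n + 1))⁻¹)

/-- The iterated logarithm `log₂ x = log (log (max e x))`. -/
noncomputable def log₂ (x : ℝ) : ℝ := Real.log (Real.log (max (Real.exp 1) x))

/-- The weights `b_n = (log n) (log₂ n) ^ γ` for `n ≥ 3`, continued by `b_n = b_3` for `n < 3`. -/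
noncomputable def logWeights (γ : ℝ) (n : ℕ) : ℝ :=
  Real.log ((max n 3 : ℕ) : ℝ) * (log₂ ((max n 3 : ℕ) : ℝ)) ^ γ

/-! ### Stationary processes and their filtrations -/

/-- Strict stationarity of a process indexed by `ℤ`: the law of the whole process is invariant
under time shifts. -/
def IsStationary {Ω S : Type*} [MeasurableSpace Ω] [MeasurableSpace S]
    (ξ : ℤ → Ω → S) (P : Measure Ω) : Prop :=
  ∀ k : ℤ, IdentDistrib (fun ω (i : ℤ) => ξ (i + k) ω) (fun ω (i : ℤ) => ξ i ω) P P

/-- The filtration `F_k = σ(ξ_i : i ≤ k)` generated by a process indexed by `ℤ`. -/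
def pastFiltration {Ω S : Type*} [mΩ : MeasurableSpace Ω] [mS : MeasurableSpace S]
    (ξ : ℤ → Ω → S) (hξ : ∀ i, Measurable (ξ i)) : Filtration ℤ mΩ where
  seq k := ⨆ (i : ℤ) (_ : i ≤ k), mS.comap (ξ i)
  mono' := fun _ _ hjk => iSup₂_le fun i hi =>
    le_iSup₂ (f := fun (i : ℤ) _ => mS.comap (ξ i)) i (hi.trans hjk)
  le' := fun _ => iSup₂_le fun i _ => (hξ i).comap_le

/-- The Markov property: given the past up to time `k`, the conditional law of `ξ_{k+1}` only
depends on `ξ_k`. -/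
def HasMarkovProperty {Ω S : Type*} [mΩ : MeasurableSpace Ω] [mS : MeasurableSpace S]
    (ξ : ℤ → Ω → S) (hξ : ∀ i, Measurable (ξ i)) (P : Measure Ω) : Prop :=
  ∀ (k : ℤ) (A : Set S), MeasurableSet A →
    P[(ξ (k + 1) ⁻¹' A).indicator (fun _ => (1 : ℝ)) | pastFiltration ξ hξ k]
      =ᵐ[P] P[(ξ (k + 1) ⁻¹' A).indicator (fun _ => (1 : ℝ)) | mS.comap (ξ k)]

/-- The iterate `T ^ i`, `i ∈ ℤ`, of a bijective bimeasurable transformation. -/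
def iter {Ω : Type*} [MeasurableSpace Ω] (T : Ω ≃ᵐ Ω) (i : ℤ) : Ω → Ω :=
  ⇑((T.toEquiv : Equiv.Perm Ω) ^ i)

theorem iter_add_one {Ω : Type*} [MeasurableSpace Ω] (T : Ω ≃ᵐ Ω) (i : ℤ) :
    iter T (i + 1) = T ∘ iter T i := by
  funext ω
  simp only [iter, Function.comp_apply]
  rw [add_comm, zpow_add, zpow_one]
  rfl

theorem measurable_iter {Ω : Type*} [MeasurableSpace Ω] (T : Ω ≃ᵐ Ω) (i : ℤ) :
    Measurable (iter T i) := by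
  induction i using Int.induction_on with
  | zero => exact measurable_id
  | succ n ih => rw [iter_add_one]; exact T.measurable.comp ih
  | pred n ih =>
    have h : iter T (-(n : ℤ)) = T ∘ iter T (-(n : ℤ) - 1) := by
      rw [← iter_add_one, sub_add_cancel]
    have h2 : iter T (-(n : ℤ) - 1) = T.symm ∘ iter T (-(n : ℤ)) := by
      rw [h]; funext ω; simp
    rw [h2]; exact T.symm.measurable.comp ih

/-- The filtration `F_i = T^{-i}(F_0)`, `i ∈ ℤ`, where `F_0 ⊆ T^{-1}(F_0)`. -/
def shiftFiltration {Ω : Type*} (F₀ : MeasurableSpace Ω) [mΩ : MeasurableSpace Ω]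
    (T : Ω ≃ᵐ Ω) (hF₀ : F₀ ≤ mΩ) (hT : F₀ ≤ F₀.comap T) : Filtration ℤ mΩ where
  seq i := F₀.comap (iter T i)
  mono' := by
    refine monotone_int_of_le_succ fun i => ?_
    rw [iter_add_one, ← MeasurableSpace.comap_comp]
    exact MeasurableSpace.comap_mono hT
  le' := fun i => (MeasurableSpace.comap_mono hF₀).trans (measurable_iter T i).comap_le

/-- The restriction of a filtration indexed by `ℤ` to the times `0, 1, 2, …`. -/
def natFiltration {Ω : Type*} {mΩ : MeasurableSpace Ω} (F : Filtration ℤ mΩ) :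
    Filtration ℕ mΩ where
  seq n := F (n : ℤ)
  mono' := fun _ _ h => F.mono (Int.ofNat_le.mpr h)
  le' := fun n => F.le (n : ℤ)

/-- The partial sums `S_n = X_0 + ⋯ + X_{n-1}`. -/
def partialSum {Ω : Type*} (X : ℤ → Ω → ℝ) (n : ℕ) (ω : Ω) : ℝ :=
  ∑ i ∈ Finset.range n, X (i : ℤ) ω

/-! ### The condition and the approximation -/

/-- The tail `∑_{k ≥ n} ‖E(S_k | F_0)‖ / k^{3/2}` (with `k = n + j`), as an element of `[0, ∞]`;
`‖·‖` is the norm of `L²(P)`. It is used for `n ≥ 1` only. -/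
noncomputable def projTail {Ω : Type*} {mΩ : MeasurableSpace Ω} (P : Measure Ω)
    (F : Filtration ℤ mΩ) (X : ℤ → Ω → ℝ) (n : ℕ) : ℝ≥0∞ :=
  ∑' j : ℕ, eLpNorm (P[partialSum X (n + j) | F 0]) 2 P
    / ENNReal.ofReal (((n + j : ℕ) : ℝ) ^ (3 / 2 : ℝ))

/-- The condition `∑_{n ≥ 1} (b_n / n) (∑_{k ≥ n} ‖E(S_k | F_0)‖ / k^{3/2})² < ∞`
(the outer sum is written with `n + 1`, `n ≥ 0`, in place of `n`). -/
def SlowCondition {Ω : Type*} {mΩ : MeasurableSpace Ω} (P : Measure Ω)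
    (F : Filtration ℤ mΩ) (X : ℤ → Ω → ℝ) (b : ℕ → ℝ) : Prop :=
  ∑' n : ℕ, ENNReal.ofReal (b (n + 1) / ((n + 1 : ℕ) : ℝ)) * projTail P F X (n + 1) ^ 2 < ∞

/-- `(D_k)_{k ∈ ℤ}` is a stationary sequence of square integrable martingale differences, `D_k`
being `F_{k+1}`-measurable with `E(D_k | F_k) = 0`, and `M_n = D_0 + ⋯ + D_{n-1}` is a martingale
with `(S_n - M_n) / √n → 0` almost surely. -/
structure IsASMartingaleApprox {Ω : Type*} {mΩ : MeasurableSpace Ω} (P : Measure Ω)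
    (F : Filtration ℤ mΩ) (X D : ℤ → Ω → ℝ) : Prop where
  stationary : IsStationary D P
  memLp : ∀ k : ℤ, MemLp (D k) 2 P
  adapted : ∀ k : ℤ, StronglyMeasurable[F (k + 1)] (D k)
  condExp_eq_zero : ∀ k : ℤ, P[D k | F k] =ᵐ[P] 0
  martingale : Martingale (partialSum D) (natFiltration F) P
  tendsto : ∀ᵐ ω ∂P, Tendsto
    (fun n : ℕ => (partialSum X n ω - partialSum D n ω) / Real.sqrt n) atTop (𝓝 0)

end MartApprox

/-!
Let `U` be the Koopman operator of `T` on `L²(P)`, `E` the orthogonal projection onto the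
`F₀`-measurable functions, `Q = E U` and `V_n = ∑_{k < n} Q ^ k`, so that `E(S_n | F₀) = V_n x` for
`x = X₀`. The potentials `h_i = 2^{-(i+1)} V_{2^i}² x` satisfy
`h_i - Q h_i = 2^{-i} V_{2^i} x - 2^{-(i+1)} V_{2^{i+1}} x`, which telescopes to `x`, while the
innovations `U h_i - Q h_i` are martingale differences of norm at most `‖V_{2^i} x‖ / 2^{i/2}`.
Hence `d = ∑ (U h_i - Q h_i)` converges, and the slow condition gives
`∑ β_J 2^{-J} ‖∑_{k < 2^J} U ^ k (x - d)‖² < ∞` for weights `β_J` with `∑ 1 / β_J < ∞`. Dyadic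
chaining and the maximal ergodic lemma turn this into `∑_{k < n} (x - d) ∘ T ^ k = o(√n)` almost
surely. A stationary process with its past is a factor of the shift on the space of two-sided paths,
so it inherits the approximation from there.
-/

namespace MartApprox

section PowerSum

variable {𝕜 E : Type*} [NontriviallyNormedField 𝕜] [SeminormedAddCommGroup E] [NormedSpace 𝕜 E]

/-- The sum `1 + q + ⋯ + q ^ (n - 1)` of the powers of a bounded operator. If `q` is the operator
`x ↦ E(x ∘ T | F₀)` of `L²(F₀)`, it maps `x` to `E(x + x ∘ T + ⋯ + x ∘ T ^ (n - 1) | F₀)`. -/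
noncomputable def powerSum (q : E →L[𝕜] E) (n : ℕ) : E →L[𝕜] E :=
  ∑ k ∈ Finset.range n, q ^ k

theorem powerSum_apply (q : E →L[𝕜] E) (n : ℕ) (x : E) :
    powerSum q n x = ∑ k ∈ Finset.range n, (q ^ k) x := by
  simp only [powerSum, sum_apply]

theorem powerSum_one (q : E →L[𝕜] E) : powerSum q 1 = 1 := by
  simp [powerSum]

theorem powerSum_add_apply (q : E →L[𝕜] E) (m n : ℕ) (x : E) :
    powerSum q (m + n) x = powerSum q m x + (q ^ m) (powerSum q n x) := by
  simp only [powerSum_apply, Finset.sum_range_add, pow_add, mul_apply_eq_comp, map_sum]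

theorem powerSum_succ_apply (q : E →L[𝕜] E) (n : ℕ) (x : E) :
    powerSum q (n + 1) x = x + q (powerSum q n x) := by
  rw [add_comm, powerSum_add_apply, powerSum_one, pow_one, one_apply_eq_self]

theorem powerSum_apply_sub (q : E →L[𝕜] E) (n : ℕ) (x : E) :
    powerSum q n (x - q x) = x - (q ^ n) x :=
  congrArg (fun A : E →L[𝕜] E => A x) (geom_sum_mul_neg q n)

theorem powerSum_sub_apply (q : E →L[𝕜] E) (n : ℕ) (x : E) :
    powerSum q n x - q (powerSum q n x) = x - (q ^ n) x :=
  congrArg (fun A : E →L[𝕜] E => A x) (mul_neg_geom_sum q n)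

variable {q : E →L[𝕜] E}

theorem norm_pow_apply_le (hq : ‖q‖ ≤ 1) (n : ℕ) (x : E) : ‖(q ^ n) x‖ ≤ ‖x‖ := by
  induction n with
  | zero => simp
  | succ n ih =>
    rw [pow_succ']
    exact (q.le_of_opNorm_le hq _).trans ((one_mul _).trans_le ih)

theorem norm_sub_pow_apply_le (hq : ‖q‖ ≤ 1) (n : ℕ) (x : E) : ‖x - (q ^ n) x‖ ≤ 2 * ‖x‖ := by
  rw [two_mul]
  exact (norm_sub_le _ _).trans (add_le_add_right (norm_pow_apply_le hq n x) _)

theorem norm_powerSum_apply_le (hq : ‖q‖ ≤ 1) (n : ℕ) (x : E) : ‖powerSum q n x‖ ≤ n * ‖x‖ := by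
  rw [powerSum_apply]
  exact (norm_sum_le_of_le _ fun k _ => norm_pow_apply_le hq k x).trans_eq (by simp)

theorem norm_powerSum_le_add (hq : ‖q‖ ≤ 1) (m n : ℕ) (x : E) :
    ‖powerSum q m x‖ ≤ ‖powerSum q n x‖ + ‖powerSum q (n + m) x‖ := by
  have hsplit : powerSum q m x = powerSum q (m + n) x - (q ^ m) (powerSum q n x) := by
    rw [powerSum_add_apply, add_sub_cancel_right]
  rw [hsplit, add_comm ‖powerSum q n x‖, add_comm n m]
  exact (norm_sub_le _ _).trans (add_le_add_right (norm_pow_apply_le hq m _) _)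

end PowerSum

section DyadicPotential

variable {𝕜 E : Type*} [RCLike 𝕜] [SeminormedAddCommGroup E] [NormedSpace 𝕜 E]

/-- The potential `h_i = 2^{-(i+1)} V² x`, with `V = 1 + q + ⋯ + q ^ (2 ^ i - 1)`: it solves the
Poisson equation `h - q h = A_i x - A_{i+1} x` between the averages `A_i = 2^{-i} V` of the powers
of `q` at two consecutive dyadic scales. -/
noncomputable def dyadicPotential (q : E →L[𝕜] E) (x : E) (i : ℕ) : E :=
  ((2 : 𝕜) ^ (i + 1))⁻¹ • powerSum q (2 ^ i) (powerSum q (2 ^ i) x)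

theorem dyadicPotential_sub_apply (q : E →L[𝕜] E) (x : E) (i : ℕ) :
    dyadicPotential q x i - q (dyadicPotential q x i)
      = ((2 : 𝕜) ^ (i + 1))⁻¹ • (powerSum q (2 ^ i) x - (q ^ 2 ^ i) (powerSum q (2 ^ i) x)) := by
  rw [dyadicPotential, map_smul, ← smul_sub, powerSum_sub_apply]

theorem dyadicPotential_sub_apply_eq_sub (q : E →L[𝕜] E) (x : E) (i : ℕ) :
    dyadicPotential q x i - q (dyadicPotential q x i)
      = ((2 : 𝕜) ^ i)⁻¹ • powerSum q (2 ^ i) x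
        - ((2 : 𝕜) ^ (i + 1))⁻¹ • powerSum q (2 ^ (i + 1)) x := by
  have hdouble : powerSum q (2 ^ (i + 1)) x
      = powerSum q (2 ^ i) x + (q ^ 2 ^ i) (powerSum q (2 ^ i) x) := by
    rw [pow_succ, mul_two, powerSum_add_apply]
  rw [dyadicPotential_sub_apply, hdouble, pow_succ, mul_inv]
  module

theorem sum_dyadicPotential_sub_apply (q : E →L[𝕜] E) (x : E) (J : ℕ) :
    ∑ i ∈ Finset.range J, (dyadicPotential q x i - q (dyadicPotential q x i))
      = x - ((2 : 𝕜) ^ J)⁻¹ • powerSum q (2 ^ J) x := by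
  simp only [dyadicPotential_sub_apply_eq_sub, Finset.sum_range_sub']
  simp [powerSum_one]

variable {q : E →L[𝕜] E}

theorem norm_dyadicPotential_le (hq : ‖q‖ ≤ 1) (x : E) (i : ℕ) :
    ‖dyadicPotential q x i‖ ≤ ‖powerSum q (2 ^ i) x‖ / 2 := by
  rw [dyadicPotential, norm_smul, norm_inv, norm_pow, RCLike.norm_two,
    inv_mul_le_iff₀ (by positivity)]
  refine (norm_powerSum_apply_le hq _ _).trans_eq ?_
  push_cast
  ring

theorem norm_dyadicPotential_sub_apply_le (hq : ‖q‖ ≤ 1) (x : E) (i : ℕ) :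
    ‖dyadicPotential q x i - q (dyadicPotential q x i)‖
      ≤ ((2 : ℝ) ^ i)⁻¹ * ‖powerSum q (2 ^ i) x‖ := by
  rw [dyadicPotential_sub_apply, norm_smul, norm_inv, norm_pow, RCLike.norm_two, pow_succ, mul_inv,
    mul_assoc]
  gcongr
  linarith [norm_sub_pow_apply_le hq (2 ^ i) (powerSum q (2 ^ i) x)]

end DyadicPotential

section Innovation

variable {𝕜 H : Type*} [RCLike 𝕜] [NormedAddCommGroup H] [InnerProductSpace 𝕜 H]

/-- The subspace `U K ⊖ K` for an isometry `U` with `K ≤ U K`. For the Koopman operator of `T` and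
`K = L²(F₀)` it consists of the square integrable martingale differences at time `0`. -/
def innovationSpace (U : H →ₗᵢ[𝕜] H) (K : Submodule 𝕜 H) : Submodule 𝕜 H :=
  K.map U.toLinearMap ⊓ Kᗮ

variable (U : H →ₗᵢ[𝕜] H) {K : Submodule 𝕜 H}

theorem isClosed_innovationSpace [CompleteSpace H] [K.HasOrthogonalProjection] :
    IsClosed (innovationSpace U K : Set H) := by
  have hK : IsClosed (K : Set H) := by
    rw [← K.orthogonal_orthogonal]
    exact Submodule.isClosed_orthogonal _
  rw [innovationSpace, Submodule.coe_inf, Submodule.map_coe]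
  exact (U.isometry.isClosedEmbedding.isClosedMap _ hK).inter K.isClosed_orthogonal

theorem map_mem_orthogonal (hK : K ≤ K.map U.toLinearMap) {v : H} (hv : v ∈ Kᗮ) : U v ∈ Kᗮ := by
  intro y hy
  obtain ⟨z, hz, rfl⟩ := hK hy
  exact (U.inner_map_map z v).trans (hv z hz)

theorem powerSum_mem_orthogonal (hK : K ≤ K.map U.toLinearMap) {v : H} (hv : v ∈ Kᗮ) (n : ℕ) :
    powerSum U.toContinuousLinearMap n v ∈ Kᗮ := by
  induction n with
  | zero => simp [powerSum]
  | succ n ih =>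
    rw [powerSum_succ_apply]
    exact Kᗮ.add_mem hv (map_mem_orthogonal U hK ih)

theorem norm_powerSum_sq_of_mem_innovationSpace (hK : K ≤ K.map U.toLinearMap) {e : H}
    (he : e ∈ innovationSpace U K) (n : ℕ) :
    ‖powerSum U.toContinuousLinearMap n e‖ ^ 2 = n * ‖e‖ ^ 2 := by
  induction n with
  | zero => simp [powerSum]
  | succ n ih =>
    have horth : inner 𝕜 e (U (powerSum U.toContinuousLinearMap n e)) = 0 := by
      obtain ⟨⟨z, hz, hze⟩, he'⟩ := he
      rw [← hze]
      exact (U.inner_map_map _ _).trans (powerSum_mem_orthogonal U hK (hze ▸ he') n z hz)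
    rw [powerSum_succ_apply, sq]
    refine (norm_add_sq_eq_norm_sq_add_norm_sq_of_inner_eq_zero _ _ horth).trans ?_
    rw [← sq, ← sq]
    refine (congrArg (‖e‖ ^ 2 + · ^ 2) (U.norm_map _)).trans ?_
    rw [ih]
    push_cast
    ring

theorem norm_powerSum_of_mem_innovationSpace (hK : K ≤ K.map U.toLinearMap) {e : H}
    (he : e ∈ innovationSpace U K) (n : ℕ) :
    ‖powerSum U.toContinuousLinearMap n e‖ = √n * ‖e‖ := by
  rw [← Real.sqrt_sq (norm_nonneg (powerSum _ n e)),
    norm_powerSum_sq_of_mem_innovationSpace U hK he, Real.sqrt_mul (Nat.cast_nonneg n),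
    Real.sqrt_sq (norm_nonneg e)]

variable (K) [K.HasOrthogonalProjection]

/-- The compression `E U` of an isometry `U` to the range `K` of the orthogonal projection `E`. For
the Koopman operator of `T` and `K = L²(F₀)` it is `x ↦ E(x ∘ T | F₀)`. -/
noncomputable def compression : H →L[𝕜] H :=
  K.starProjection * U.toContinuousLinearMap

theorem compression_apply (x : H) : compression U K x = K.starProjection (U x) := rfl

theorem norm_compression_le_one : ‖compression U K‖ ≤ 1 :=
  (norm_mul_le _ _).trans
    (mul_le_one₀ K.starProjection_norm_le (norm_nonneg _) U.norm_toContinuousLinearMap_le)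

/-- The innovation `U h - E U h`, where `E` is the orthogonal projection onto `K`. -/
noncomputable def innovation : H →L[𝕜] H := U.toContinuousLinearMap - compression U K

theorem innovation_apply (h : H) : innovation U K h = U h - compression U K h := rfl

/-- By the Pythagorean theorem `‖U h - E U h‖² = ‖h‖² - ‖E U h‖²`, and `‖h‖ - ‖E U h‖` is at most
`‖h - E U h‖`. -/
theorem norm_innovation_sq_le (h : H) :
    ‖innovation U K h‖ ^ 2 ≤ 2 * ‖h - compression U K h‖ * ‖h‖ := by
  have hpyth : ‖h‖ ^ 2 = ‖compression U K h‖ ^ 2 + ‖innovation U K h‖ ^ 2 := by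
    rw [← U.norm_map, K.norm_sq_eq_add_norm_sq_starProjection (U h),
      K.starProjection_orthogonal_val]
    rfl
  have hdiff : ‖h‖ - ‖compression U K h‖ ≤ ‖h - compression U K h‖ := norm_sub_norm_le _ _
  have hle : ‖compression U K h‖ ≤ ‖h‖ := by
    simpa using (compression U K).le_of_opNorm_le (norm_compression_le_one U K) h
  nlinarith [norm_nonneg h, norm_nonneg (compression U K h), norm_nonneg (h - compression U K h)]

variable {K}

theorem innovation_mem_innovationSpace (hK : K ≤ K.map U.toLinearMap) {h : H} (hh : h ∈ K) :
    innovation U K h ∈ innovationSpace U K :=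
  ⟨Submodule.sub_mem _ (Submodule.mem_map_of_mem hh) (hK (K.starProjection_apply_mem _)),
    K.sub_starProjection_mem_orthogonal _⟩

theorem starProjection_map (hK : K ≤ K.map U.toLinearMap) (y : H) :
    K.starProjection (U y) = compression U K (K.starProjection y) := by
  have hmem := map_mem_orthogonal U hK (K.sub_starProjection_mem_orthogonal y)
  rw [← sub_eq_zero, compression_apply, ← map_sub, ← map_sub]
  exact K.starProjection_apply_eq_zero_iff.2 hmem

theorem starProjection_powerSum (hK : K ≤ K.map U.toLinearMap) {x : H} (hx : x ∈ K) (n : ℕ) :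
    K.starProjection (powerSum U.toContinuousLinearMap n x) = powerSum (compression U K) n x := by
  induction n with
  | zero => simp [powerSum]
  | succ n ih =>
    rw [powerSum_succ_apply, powerSum_succ_apply, map_add, K.starProjection_eq_self_iff.2 hx, ← ih]
    exact congrArg _ (starProjection_map U hK _)

theorem powerSum_compression_mem {x : H} (hx : x ∈ K) (n : ℕ) :
    powerSum (compression U K) n x ∈ K := by
  cases n with
  | zero => simp [powerSum]
  | succ n =>
    rw [powerSum_succ_apply]
    exact K.add_mem hx (K.starProjection_apply_mem _)

theorem dyadicPotential_compression_mem {x : H} (hx : x ∈ K) (i : ℕ) :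
    dyadicPotential (compression U K) x i ∈ K :=
  K.smul_mem _ (powerSum_compression_mem U (powerSum_compression_mem U hx _) _)

variable (K)

theorem norm_innovation_dyadicPotential_le (x : H) (i : ℕ) :
    ‖innovation U K (dyadicPotential (compression U K) x i)‖
      ≤ ‖powerSum (compression U K) (2 ^ i) x‖ / √(2 ^ i) := by
  have hq := norm_compression_le_one U K
  refine abs_le_of_sq_le_sq' ?_ (by positivity) |>.2
  rw [div_pow, Real.sq_sqrt (by positivity)]
  calc ‖innovation U K (dyadicPotential (compression U K) x i)‖ ^ 2
      ≤ 2 * (((2 : ℝ) ^ i)⁻¹ * ‖powerSum (compression U K) (2 ^ i) x‖)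
          * (‖powerSum (compression U K) (2 ^ i) x‖ / 2) := by
        refine (norm_innovation_sq_le U K _).trans ?_
        gcongr
        · exact norm_dyadicPotential_sub_apply_le hq x i
        · exact norm_dyadicPotential_le hq x i
    _ = _ := by field_simp

/-- The martingale difference approximating `x`: the sum of the innovations of the dyadic potentials
of `x` with respect to the compression of `U`. -/
noncomputable def innovationSeries (x : H) : H :=
  ∑' i, innovation U K (dyadicPotential (compression U K) x i)

variable {K} [CompleteSpace H] {x : H}

theorem innovationSeries_mem_innovationSpace (hK : K ≤ K.map U.toLinearMap) (hx : x ∈ K) :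
    innovationSeries U K x ∈ innovationSpace U K :=
  tsum_mem (isClosed_innovationSpace U)
    fun i => innovation_mem_innovationSpace U hK (dyadicPotential_compression_mem U hx i)

theorem summable_innovation_dyadicPotential
    (hsum : Summable fun i : ℕ => ‖powerSum (compression U K) (2 ^ i) x‖ / √(2 ^ i)) :
    Summable fun i => innovation U K (dyadicPotential (compression U K) x i) :=
  hsum.of_norm_bounded (norm_innovation_dyadicPotential_le U K x)

theorem sub_innovationSeries
    (hsum : Summable fun i : ℕ => ‖powerSum (compression U K) (2 ^ i) x‖ / √(2 ^ i)) (J : ℕ) :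
    x - innovationSeries U K x
      = ∑ i ∈ Finset.range J, (dyadicPotential (compression U K) x i
            - U (dyadicPotential (compression U K) x i))
        - ∑' i, innovation U K (dyadicPotential (compression U K) x (i + J))
        + ((2 : 𝕜) ^ J)⁻¹ • powerSum (compression U K) (2 ^ J) x := by
  set h := dyadicPotential (compression U K) x
  have hcobound : ∀ i, h i - U (h i) = (h i - compression U K (h i)) - innovation U K (h i) := by
    intro i
    rw [innovation_apply]
    abel
  rw [innovationSeries, ← (summable_innovation_dyadicPotential U hsum).sum_add_tsum_nat_add J,
    Finset.sum_congr rfl fun i _ => hcobound i, Finset.sum_sub_distrib,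
    sum_dyadicPotential_sub_apply]
  abel

/-- The three terms bound the contributions of the coboundaries up to scale `J`, of the remaining
innovations, and of the average at scale `J`. -/
theorem norm_powerSum_sub_innovationSeries_le (hK : K ≤ K.map U.toLinearMap) (hx : x ∈ K)
    (hsum : Summable fun i : ℕ => ‖powerSum (compression U K) (2 ^ i) x‖ / √(2 ^ i)) (J : ℕ) :
    ‖powerSum U.toContinuousLinearMap (2 ^ J) (x - innovationSeries U K x)‖
      ≤ ∑ i ∈ Finset.range J, ‖powerSum (compression U K) (2 ^ i) x‖
        + √(2 ^ J) * (∑' i : ℕ, ‖powerSum (compression U K) (2 ^ (i + J)) x‖ / √(2 ^ (i + J)))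
        + ‖powerSum (compression U K) (2 ^ J) x‖ := by
  have hU := U.norm_toContinuousLinearMap_le
  have hq := norm_compression_le_one U K
  rw [sub_innovationSeries U hsum J, map_add, map_sub, map_sum]
  refine (norm_add_le _ _).trans (add_le_add ((norm_sub_le _ _).trans (add_le_add ?_ ?_)) ?_)
  · refine norm_sum_le_of_le _ fun i _ => ?_
    refine (congrArg _ (powerSum_apply_sub U.toContinuousLinearMap _ _)).trans_le ?_
    linarith [norm_sub_pow_apply_le hU (2 ^ J) (dyadicPotential (compression U K) x i),
      norm_dyadicPotential_le hq x i]
  · have hmem : ∑' i, innovation U K (dyadicPotential (compression U K) x (i + J))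
        ∈ innovationSpace U K :=
      tsum_mem (isClosed_innovationSpace U) fun i =>
        innovation_mem_innovationSpace U hK (dyadicPotential_compression_mem U hx _)
    rw [norm_powerSum_of_mem_innovationSpace U hK hmem]
    push_cast
    gcongr
    exact tsum_of_norm_bounded ((summable_nat_add_iff J).2 hsum).hasSum
      fun i => norm_innovation_dyadicPotential_le U K x _
  · refine (norm_powerSum_apply_le hU _ _).trans_eq ?_
    rw [norm_smul, norm_inv, norm_pow, RCLike.norm_two, Nat.cast_pow, Nat.cast_ofNat,
      mul_inv_cancel_left₀ (by positivity)]

end Innovation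

section DyadicChaining

/-- The average of `y` over the window `p, …, p + 2 ^ i - 1` of length `2 ^ i`. -/
noncomputable def dyadicAvg (y : ℕ → ℝ) (i p : ℕ) : ℝ :=
  ((2 : ℝ) ^ i)⁻¹ * ∑ l ∈ Finset.range (2 ^ i), y (p + l)

/-- The boundary term of the dyadic chaining at scale `i`: the sum over `p, …, p + 2 ^ i - 1` of the
averages at that scale. -/
noncomputable def windowSum (y : ℕ → ℝ) (i p : ℕ) : ℝ :=
  ∑ l ∈ Finset.range (2 ^ i), dyadicAvg y i (p + l)

/-- `G` dominates the square functions `∑_i β_i 2 ^ i (dyadicAvg y i p) ^ 2` of a sequence `y` with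
weights `β`. -/
def IsDyadicMajorant (β y G : ℕ → ℝ) : Prop :=
  ∀ p J, ∑ i ∈ Finset.range J, β i * (2 ^ i * dyadicAvg y i p ^ 2) ≤ G p

theorem dyadicAvg_zero (y : ℕ → ℝ) (p : ℕ) : dyadicAvg y 0 p = y p := by simp [dyadicAvg]

theorem dyadicAvg_succ (y : ℕ → ℝ) (i p : ℕ) :
    dyadicAvg y (i + 1) p = (dyadicAvg y i p + dyadicAvg y i (p + 2 ^ i)) / 2 := by
  simp only [dyadicAvg]
  rw [pow_succ (2 : ℕ) i, mul_two (2 ^ i : ℕ), Finset.sum_range_add, pow_succ (2 : ℝ), mul_inv]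
  simp only [add_assoc]
  ring

theorem sum_dyadicAvg_sub (y : ℕ → ℝ) (i n : ℕ) :
    ∑ k ∈ Finset.range n, dyadicAvg y i k - ∑ k ∈ Finset.range n, dyadicAvg y (i + 1) k
      = (windowSum y i 0 - windowSum y i n) / 2 := by
  have hsplit := Finset.sum_range_add (dyadicAvg y i) (2 ^ i) n
  have hsplit' := Finset.sum_range_add (dyadicAvg y i) n (2 ^ i)
  rw [add_comm, hsplit'] at hsplit
  simp only [dyadicAvg_succ, windowSum, zero_add, ← Finset.sum_div, Finset.sum_add_distrib,
    add_comm _ (2 ^ i)]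
  linarith

theorem sum_eq_windowSum_add (y : ℕ → ℝ) (n J : ℕ) :
    ∑ k ∈ Finset.range n, y k = (∑ i ∈ Finset.range J, windowSum y i 0
      - ∑ i ∈ Finset.range J, windowSum y i n) / 2 + ∑ k ∈ Finset.range n, dyadicAvg y J k := by
  rw [← Finset.sum_sub_distrib, Finset.sum_div,
    ← Finset.sum_congr rfl fun i _ => sum_dyadicAvg_sub y i n, Finset.sum_range_sub']
  simp [dyadicAvg_zero]

theorem sq_windowSum_le (y : ℕ → ℝ) (i p : ℕ) :
    windowSum y i p ^ 2 ≤ ∑ l ∈ Finset.range (2 ^ i), 2 ^ i * dyadicAvg y i (p + l) ^ 2 := by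
  simpa [windowSum, Finset.mul_sum] using sq_sum_le_card_mul_sum_sq (s := Finset.range (2 ^ i))
    (f := fun l => dyadicAvg y i (p + l))

variable {β y G : ℕ → ℝ}

theorem IsDyadicMajorant.nonneg (hG : IsDyadicMajorant β y G) (p : ℕ) : 0 ≤ G p := by
  simpa using hG p 0

theorem IsDyadicMajorant.sum_Ico_le (hG : IsDyadicMajorant β y G) (hβ : ∀ i, 0 < β i)
    (m J p : ℕ) : ∑ i ∈ Finset.Ico m J, β i * (2 ^ i * dyadicAvg y i p ^ 2) ≤ G p := by
  refine le_trans (Finset.sum_le_sum_of_subset_of_nonneg ?_ fun i _ _ => ?_) (hG p J)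
  · exact fun i hi => Finset.mem_range.2 (Finset.mem_Ico.1 hi).2
  · exact mul_nonneg (hβ i).le (by positivity)

theorem IsDyadicMajorant.sq_sum_windowSum_le (hG : IsDyadicMajorant β y G) (hβ : ∀ i, 0 < β i)
    (p m J : ℕ) :
    (∑ i ∈ Finset.Ico m J, windowSum y i p) ^ 2
      ≤ (∑ i ∈ Finset.Ico m J, (β i)⁻¹) * ∑ l ∈ Finset.range (2 ^ J), G (p + l) := by
  have hterm : ∀ i p, 0 ≤ β i * (2 ^ i * dyadicAvg y i p ^ 2) := fun i p =>
    mul_nonneg (hβ i).le (by positivity)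
  refine (Finset.sum_sq_le_sum_mul_sum_of_sq_le_mul (Finset.Ico m J)
    (f := fun i => (β i)⁻¹) (g := fun i => β i * windowSum y i p ^ 2)
    (fun i _ => (inv_pos.2 (hβ i)).le) (fun i _ => mul_nonneg (hβ i).le (sq_nonneg _))
    (fun i _ => (inv_mul_cancel_left₀ (hβ i).ne' _).ge)).trans ?_
  refine mul_le_mul_of_nonneg_left ?_ (Finset.sum_nonneg fun i _ => (inv_pos.2 (hβ i)).le)
  calc ∑ i ∈ Finset.Ico m J, β i * windowSum y i p ^ 2
      ≤ ∑ i ∈ Finset.Ico m J, ∑ l ∈ Finset.range (2 ^ J),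
          β i * (2 ^ i * dyadicAvg y i (p + l) ^ 2) := by
        refine Finset.sum_le_sum fun i hi => ?_
        refine (mul_le_mul_of_nonneg_left (sq_windowSum_le y i p) (hβ i).le).trans ?_
        rw [Finset.mul_sum]
        refine Finset.sum_le_sum_of_subset_of_nonneg ?_ fun l _ _ => hterm _ _
        exact Finset.range_subset_range.2
          (Nat.pow_le_pow_right two_pos (Finset.mem_Ico.1 hi).2.le)
    _ = ∑ l ∈ Finset.range (2 ^ J), ∑ i ∈ Finset.Ico m J,
          β i * (2 ^ i * dyadicAvg y i (p + l) ^ 2) := Finset.sum_comm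
    _ ≤ _ := Finset.sum_le_sum fun l _ => hG.sum_Ico_le hβ m J (p + l)

theorem IsDyadicMajorant.sq_sum_dyadicAvg_le (hG : IsDyadicMajorant β y G) (hβ : ∀ i, 0 < β i)
    (n J : ℕ) :
    (∑ k ∈ Finset.range n, dyadicAvg y J k) ^ 2
      ≤ n * ((β J * 2 ^ J)⁻¹ * ∑ k ∈ Finset.range n, G k) := by
  have hcauchy := sq_sum_le_card_mul_sum_sq (s := Finset.range n) (f := dyadicAvg y J)
  rw [Finset.card_range] at hcauchy
  refine hcauchy.trans (mul_le_mul_of_nonneg_left ?_ (Nat.cast_nonneg n))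
  rw [Finset.mul_sum]
  refine Finset.sum_le_sum fun k _ => ?_
  rw [le_inv_mul_iff₀ (mul_pos (hβ J) (by positivity)), mul_assoc]
  simpa using hG.sum_Ico_le hβ J (J + 1) k

theorem IsDyadicMajorant.abs_sum_windowSum_le (hG : IsDyadicMajorant β y G) (hβ : ∀ i, 0 < β i)
    {C t : ℝ} (hC : ∀ n : ℕ, ∑ k ∈ Finset.range n, G k ≤ C * n) {m J n p : ℕ}
    (ht : ∑ i ∈ Finset.Ico m J, (β i)⁻¹ ≤ t) (hp : p + 2 ^ J ≤ 2 * n) :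
    |∑ i ∈ Finset.Ico m J, windowSum y i p| ≤ √(2 * C * t) * √n := by
  have ht₀ : 0 ≤ t := (Finset.sum_nonneg fun i _ => (inv_pos.2 (hβ i)).le).trans ht
  have hsum : ∑ l ∈ Finset.range (2 ^ J), G (p + l) ≤ C * (2 * n) := by
    calc ∑ l ∈ Finset.range (2 ^ J), G (p + l)
        ≤ ∑ l ∈ Finset.range (p + 2 ^ J), G l := by
          rw [Finset.sum_range_add]
          exact le_add_of_nonneg_left (Finset.sum_nonneg fun i _ => hG.nonneg i)
      _ ≤ ∑ l ∈ Finset.range (2 * n), G l :=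
          Finset.sum_le_sum_of_subset_of_nonneg (Finset.range_subset_range.2 hp)
            fun l _ _ => hG.nonneg l
      _ ≤ C * (2 * n) := by exact_mod_cast hC (2 * n)
  rw [← Real.sqrt_mul' _ (Nat.cast_nonneg n)]
  refine Real.abs_le_sqrt ((hG.sq_sum_windowSum_le hβ p m J).trans ?_)
  calc _ ≤ t * (C * (2 * n)) :=
        mul_le_mul ht hsum (Finset.sum_nonneg fun l _ => hG.nonneg _) ht₀
    _ = 2 * C * t * n := by ring

theorem IsDyadicMajorant.abs_sum_dyadicAvg_le (hG : IsDyadicMajorant β y G) (hβ : ∀ i, 0 < β i)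
    {C t : ℝ} (hC : ∀ n : ℕ, ∑ k ∈ Finset.range n, G k ≤ C * n) {J n : ℕ}
    (ht : (β J)⁻¹ ≤ t) (hn : n ≤ 2 * 2 ^ J) :
    |∑ k ∈ Finset.range n, dyadicAvg y J k| ≤ √(2 * C * t) * √n := by
  have hβJ := hβ J
  have hCn : 0 ≤ C * n := (Finset.sum_nonneg fun k _ => hG.nonneg k).trans (hC n)
  have hratio : (n : ℝ) * (2 ^ J)⁻¹ ≤ 2 := by
    rw [mul_inv_le_iff₀ (by positivity)]
    exact_mod_cast hn
  rw [← Real.sqrt_mul' _ (Nat.cast_nonneg n)]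
  refine Real.abs_le_sqrt ((hG.sq_sum_dyadicAvg_le hβ n J).trans ?_)
  calc (n : ℝ) * ((β J * 2 ^ J)⁻¹ * ∑ k ∈ Finset.range n, G k)
      ≤ n * ((β J * 2 ^ J)⁻¹ * (C * n)) := by
        gcongr
        exact hC n
    _ = (n * (2 ^ J)⁻¹) * ((β J)⁻¹ * (C * n)) := by rw [mul_inv]; ring
    _ ≤ 2 * (t * (C * n)) := by gcongr
    _ = 2 * C * t * n := by ring

theorem IsDyadicMajorant.abs_sum_le (hG : IsDyadicMajorant β y G) (hβ : ∀ i, 0 < β i)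
    (hβs : Summable fun i => (β i)⁻¹) {C : ℝ} (hC : ∀ n : ℕ, ∑ k ∈ Finset.range n, G k ≤ C * n)
    {m n : ℕ} (hmn : 2 ^ m ≤ n) :
    |∑ k ∈ Finset.range n, y k| ≤ ∑ i ∈ Finset.range m, (|windowSum y i 0| + |windowSum y i n|)
      + 2 * √(2 * C * ∑' i, (β (i + m))⁻¹) * √n := by
  have hn₀ : n ≠ 0 := (lt_of_lt_of_le (by positivity) hmn).ne'
  set t := ∑' i, (β (i + m))⁻¹
  set J := Nat.log 2 n
  have hmJ : m ≤ J := (Nat.le_log_iff_pow_le one_lt_two hn₀).2 hmn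
  have hJn : 2 ^ J ≤ n := Nat.pow_log_le_self 2 hn₀
  have hnJ : n ≤ 2 * 2 ^ J := by
    simpa [pow_succ'] using (Nat.lt_pow_succ_log_self one_lt_two n).le
  have hts : Summable fun i => (β (i + m))⁻¹ := (summable_nat_add_iff m).2 hβs
  have hIco : ∑ i ∈ Finset.Ico m J, (β i)⁻¹ ≤ t := by
    rw [Finset.sum_Ico_eq_sum_range]
    simp only [add_comm m]
    exact hts.sum_le_tsum _ fun i _ => (inv_pos.2 (hβ _)).le
  have hJt : (β J)⁻¹ ≤ t := by
    simpa [Nat.sub_add_cancel hmJ] using hts.le_tsum (J - m) fun i _ => (inv_pos.2 (hβ _)).le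
  have hwin₀ := abs_le.1 (hG.abs_sum_windowSum_le hβ hC (p := 0) (n := n) hIco (by omega))
  have hwinₙ := abs_le.1 (hG.abs_sum_windowSum_le hβ hC (p := n) (n := n) hIco (by omega))
  have havg := abs_le.1 (hG.abs_sum_dyadicAvg_le hβ hC hJt hnJ)
  have hlow₀ := abs_le.1 (Finset.abs_sum_le_sum_abs (fun i => windowSum y i 0) (Finset.range m))
  have hlowₙ := abs_le.1 (Finset.abs_sum_le_sum_abs (fun i => windowSum y i n) (Finset.range m))
  rw [sum_eq_windowSum_add y n J, ← Finset.sum_range_add_sum_Ico _ hmJ,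
    ← Finset.sum_range_add_sum_Ico _ hmJ, Finset.sum_add_distrib, abs_le]
  constructor <;> linarith [hwin₀.1, hwin₀.2, hwinₙ.1, hwinₙ.2, havg.1, havg.2, hlow₀.1, hlow₀.2,
    hlowₙ.1, hlowₙ.2]

theorem isLittleO_sqrt_comp_add (hy : y =o[atTop] fun n : ℕ => √(n : ℝ)) (c : ℕ) :
    (fun n => y (n + c)) =o[atTop] fun n : ℕ => √(n : ℝ) := by
  refine (hy.comp_tendsto (tendsto_add_atTop_nat c)).trans_isBigO ?_
  refine Asymptotics.IsBigO.of_bound √(1 + c) ?_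
  filter_upwards [eventually_ge_atTop 1] with n hn
  have hn' : (1 : ℝ) ≤ n := by exact_mod_cast hn
  simp only [Function.comp_apply, Real.norm_eq_abs, abs_of_nonneg (Real.sqrt_nonneg _)]
  rw [← Real.sqrt_mul (by positivity)]
  refine Real.sqrt_le_sqrt ?_
  push_cast
  nlinarith [(Nat.cast_nonneg c : (0 : ℝ) ≤ c)]

theorem windowSum_isLittleO_sqrt (hy : y =o[atTop] fun n : ℕ => √(n : ℝ)) (i : ℕ) :
    (fun n => windowSum y i n) =o[atTop] fun n : ℕ => √(n : ℝ) := by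
  refine Asymptotics.IsLittleO.fun_sum fun l _ => Asymptotics.IsLittleO.const_mul_left
    (Asymptotics.IsLittleO.fun_sum fun l' _ => ?_) _
  simpa only [add_assoc] using isLittleO_sqrt_comp_add hy (l + l')

theorem IsDyadicMajorant.sum_isLittleO_sqrt (hG : IsDyadicMajorant β y G) (hβ : ∀ i, 0 < β i)
    (hβs : Summable fun i => (β i)⁻¹) {C : ℝ} (hC : ∀ n : ℕ, ∑ k ∈ Finset.range n, G k ≤ C * n)
    (hy : y =o[atTop] fun n : ℕ => √(n : ℝ)) :
    (fun n => ∑ k ∈ Finset.range n, y k) =o[atTop] fun n : ℕ => √(n : ℝ) := by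
  have htail : Tendsto (fun m => 2 * √(2 * C * ∑' i, (β (i + m))⁻¹)) atTop (𝓝 0) := by
    simpa using
      (((tendsto_sum_nat_add fun i => (β i)⁻¹).const_mul (2 * C)).sqrt).const_mul 2
  rw [Asymptotics.isLittleO_iff]
  intro ε hε
  obtain ⟨m, hm⟩ := (htail.eventually_lt_const (half_pos hε)).exists
  have hwin : (fun n : ℕ => ∑ i ∈ Finset.range m, (|windowSum y i 0| + |windowSum y i n|))
      =o[atTop] fun n : ℕ => √(n : ℝ) := by
    refine Asymptotics.IsLittleO.fun_sum fun i _ => Asymptotics.IsLittleO.add ?_ ?_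
    · refine Asymptotics.isLittleO_const_left.2 (Or.inr ?_)
      exact tendsto_norm_atTop_atTop.comp
        (Real.tendsto_sqrt_atTop.comp tendsto_natCast_atTop_atTop)
    · exact (windowSum_isLittleO_sqrt hy i).abs_left
  filter_upwards [Asymptotics.isLittleO_iff.1 hwin (half_pos hε), eventually_ge_atTop (2 ^ m)]
    with n hn hmn
  have htail_n : 2 * √(2 * C * ∑' i, (β (i + m))⁻¹) * √n ≤ ε / 2 * √n :=
    mul_le_mul_of_nonneg_right hm.le (Real.sqrt_nonneg _)
  rw [Real.norm_of_nonneg (Real.sqrt_nonneg _)] at hn ⊢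
  refine (hG.abs_sum_le hβ hβs hC hmn).trans ?_
  linarith [(le_abs_self _).trans hn]

end DyadicChaining

section MaximalErgodic

variable {Ω : Type*} {T : Ω → Ω}

/-- The running maximum `max (0, S_1 f, …, S_n f)` of the Birkhoff sums of `f`, by the recursion
`max (0, S_1 f, …, S_{n+1} f) = max (0, f + max (0, S_1 f, …, S_n f) ∘ T)`. -/
noncomputable def birkhoffMax (T : Ω → Ω) (f : Ω → ℝ) : ℕ → Ω → ℝ
  | 0 => 0
  | n + 1 => fun ω => max 0 (f ω + birkhoffMax T f n (T ω))

theorem birkhoffMax_nonneg (f : Ω → ℝ) (n : ℕ) (ω : Ω) : 0 ≤ birkhoffMax T f n ω := by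
  cases n with
  | zero => exact le_rfl
  | succ n => exact le_max_left _ _

theorem birkhoffMax_le_succ (f : Ω → ℝ) (n : ℕ) (ω : Ω) :
    birkhoffMax T f n ω ≤ birkhoffMax T f (n + 1) ω := by
  induction n generalizing ω with
  | zero => exact birkhoffMax_nonneg f 1 ω
  | succ n ih => exact max_le_max le_rfl (add_le_add_right (ih (T ω)) _)

theorem birkhoffSum_le_birkhoffMax (f : Ω → ℝ) (n : ℕ) (ω : Ω) :
    birkhoffSum T f n ω ≤ birkhoffMax T f n ω := by
  induction n generalizing ω with
  | zero => simp [birkhoffMax]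
  | succ n ih =>
    rw [birkhoffSum_succ']
    exact (add_le_add_right (ih (T ω)) _).trans (le_max_right _ _)

theorem birkhoffMax_succ_of_pos {f : Ω → ℝ} {n : ℕ} {ω : Ω} (h : 0 < birkhoffMax T f (n + 1) ω) :
    birkhoffMax T f (n + 1) ω = f ω + birkhoffMax T f n (T ω) :=
  max_eq_right ((lt_max_iff.1 h).resolve_left (lt_irrefl 0)).le

theorem birkhoffSum_sub_const (g : Ω → ℝ) (c : ℝ) (n : ℕ) (ω : Ω) :
    birkhoffSum T (fun ω => g ω - c) n ω = birkhoffSum T g n ω - c * n := by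
  simp [birkhoffSum, Finset.sum_sub_distrib, mul_comm]

theorem dyadicAvg_iterate (Y : Ω → ℝ) (ω : Ω) (i p : ℕ) :
    dyadicAvg (fun n => Y (T^[n] ω)) i p
      = ((2 : ℝ) ^ i)⁻¹ * birkhoffSum T Y (2 ^ i) (T^[p] ω) := by
  simp only [dyadicAvg, birkhoffSum, ← Function.iterate_add_apply, add_comm p]

variable [MeasurableSpace Ω] {P : Measure Ω}

theorem measurable_birkhoffSum (hT : Measurable T) {f : Ω → ℝ} (hf : Measurable f) (n : ℕ) :
    Measurable (birkhoffSum T f n) :=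
  Finset.measurable_fun_sum _ fun k _ => hf.comp (hT.iterate k)

theorem memLp_birkhoffSum (hT : MeasurePreserving T P P) {f : Ω → ℝ} {p : ℝ≥0∞}
    (hf : MemLp f p P) (n : ℕ) : MemLp (birkhoffSum T f n) p P :=
  memLp_finsetSum _ fun k _ => hf.comp_measurePreserving (hT.iterate k)

theorem measurable_birkhoffMax (hT : Measurable T) {f : Ω → ℝ} (hf : Measurable f) (n : ℕ) :
    Measurable (birkhoffMax T f n) := by
  induction n with
  | zero => exact measurable_const
  | succ n ih => exact measurable_const.max (hf.add (ih.comp hT))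

theorem integrable_birkhoffMax (hT : MeasurePreserving T P P) {f : Ω → ℝ} (hf : Integrable f P)
    (n : ℕ) : Integrable (birkhoffMax T f n) P := by
  induction n with
  | zero => exact integrable_zero _ _ _
  | succ n ih =>
    exact (integrable_zero _ _ _).sup (hf.add (hT.integrable_comp_of_integrable ih))

theorem setIntegral_birkhoffMax_pos_nonneg (hT : MeasurePreserving T P P) {f : Ω → ℝ}
    (hfm : Measurable f) (hf : Integrable f P) (n : ℕ) :
    0 ≤ ∫ ω in {ω | 0 < birkhoffMax T f n ω}, f ω ∂P := by
  cases n with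
  | zero => simp [birkhoffMax]
  | succ n =>
    set A := {ω | 0 < birkhoffMax T f (n + 1) ω}
    have hA : MeasurableSet A := measurableSet_lt measurable_const
      (measurable_birkhoffMax hT.measurable hfm (n + 1))
    have hint := integrable_birkhoffMax hT hf n
    have hint_succ := integrable_birkhoffMax hT hf (n + 1)
    have hint_comp : Integrable (fun ω => birkhoffMax T f n (T ω)) P :=
      hT.integrable_comp_of_integrable hint
    have hshift : ∫ ω, birkhoffMax T f n (T ω) ∂P = ∫ ω, birkhoffMax T f n ω ∂P := by
      conv_rhs => rw [← hT.map_eq]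
      rw [integral_map hT.measurable.aemeasurable]
      exact (measurable_birkhoffMax hT.measurable hfm n).aestronglyMeasurable
    have hsupport : ∫ ω in A, birkhoffMax T f (n + 1) ω ∂P = ∫ ω, birkhoffMax T f (n + 1) ω ∂P :=
      setIntegral_eq_integral_of_forall_compl_eq_zero fun ω hω =>
        le_antisymm (not_lt.1 hω) (birkhoffMax_nonneg f _ ω)
    have hrestrict : ∫ ω in A, birkhoffMax T f n (T ω) ∂P ≤ ∫ ω, birkhoffMax T f n (T ω) ∂P :=
      setIntegral_le_integral hint_comp (.of_forall fun ω => birkhoffMax_nonneg f n _)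
    have hmono : ∫ ω, birkhoffMax T f n ω ∂P ≤ ∫ ω, birkhoffMax T f (n + 1) ω ∂P :=
      integral_mono hint hint_succ fun ω => birkhoffMax_le_succ f n ω
    calc 0 ≤ ∫ ω in A, (birkhoffMax T f (n + 1) ω - birkhoffMax T f n (T ω)) ∂P := by
          rw [integral_sub hint_succ.integrableOn hint_comp.integrableOn, hsupport]
          linarith
      _ = ∫ ω in A, f ω ∂P :=
          setIntegral_congr_fun hA fun ω hω => by
            simp only [birkhoffMax_succ_of_pos (show 0 < birkhoffMax T f (n + 1) ω from hω),
              add_sub_cancel_right]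

theorem mul_measureReal_birkhoffMax_pos_le [IsFiniteMeasure P] (hT : MeasurePreserving T P P)
    {g : Ω → ℝ} (hgm : Measurable g) (hg : Integrable g P) (hg₀ : 0 ≤ g) (c : ℝ) (n : ℕ) :
    c * P.real {ω | 0 < birkhoffMax T (fun ω => g ω - c) n ω} ≤ ∫ ω, g ω ∂P := by
  have hHopf := setIntegral_birkhoffMax_pos_nonneg hT (hgm.sub_const c)
    (hg.sub (integrable_const c)) n
  rw [integral_sub hg.integrableOn (integrable_const c).integrableOn, setIntegral_const,
    smul_eq_mul, mul_comm, sub_nonneg] at hHopf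
  exact hHopf.trans (setIntegral_le_integral hg (.of_forall hg₀))

theorem mul_measureReal_exists_lt_birkhoffSum_le [IsFiniteMeasure P]
    (hT : MeasurePreserving T P P) {g : Ω → ℝ} (hgm : Measurable g) (hg : Integrable g P)
    (hg₀ : 0 ≤ g) {c : ℝ} (hc : 0 ≤ c) :
    c * P.real {ω | ∃ n : ℕ, c * n < birkhoffSum T g n ω} ≤ ∫ ω, g ω ∂P := by
  set A : ℕ → Set Ω := fun n => {ω | 0 < birkhoffMax T (fun ω => g ω - c) n ω}
  have hmono : Monotone A := monotone_nat_of_le_succ fun n ω hω =>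
    lt_of_lt_of_le hω (birkhoffMax_le_succ _ n ω)
  have hsub : {ω | ∃ n : ℕ, c * n < birkhoffSum T g n ω} ⊆ ⋃ n, A n := by
    rintro ω ⟨n, hn⟩
    refine Set.mem_iUnion.2 ⟨n, lt_of_lt_of_le ?_ (birkhoffSum_le_birkhoffMax _ n ω)⟩
    rwa [birkhoffSum_sub_const, sub_pos]
  have hlim : Tendsto (fun n => c * P.real (A n)) atTop (𝓝 (c * P.real (⋃ n, A n))) :=
    ((ENNReal.tendsto_toReal (measure_ne_top _ _)).comp
      (tendsto_measure_iUnion_atTop hmono)).const_mul c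
  exact (mul_le_mul_of_nonneg_left (measureReal_mono hsub) hc).trans
    (le_of_tendsto' hlim fun n => mul_measureReal_birkhoffMax_pos_le hT hgm hg hg₀ c n)

theorem ae_exists_birkhoffSum_le [IsFiniteMeasure P] (hT : MeasurePreserving T P P)
    {g : Ω → ℝ} (hgm : Measurable g) (hg : Integrable g P) (hg₀ : 0 ≤ g) :
    ∀ᵐ ω ∂P, ∃ C : ℝ, ∀ n : ℕ, birkhoffSum T g n ω ≤ C * n := by
  set B : Set Ω := {ω | ∀ c : ℕ, ∃ n : ℕ, (c : ℝ) * n < birkhoffSum T g n ω}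
  have hBsub : ∀ c : ℕ, B ⊆ {ω | ∃ n : ℕ, (c : ℝ) * n < birkhoffSum T g n ω} := fun c ω hω => hω c
  have hle : ∀ c : ℕ, c * P.real B ≤ ∫ ω, g ω ∂P := fun c =>
    (mul_le_mul_of_nonneg_left (measureReal_mono (hBsub c)) (Nat.cast_nonneg c)).trans
      (mul_measureReal_exists_lt_birkhoffSum_le hT hgm hg hg₀ (Nat.cast_nonneg c))
  have hB : P B = 0 := by
    rw [← measureReal_eq_zero_iff]
    by_contra hne
    have hpos : 0 < P.real B := measureReal_nonneg.lt_of_ne' hne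
    obtain ⟨c, hc⟩ := exists_nat_gt ((∫ ω, g ω ∂P) / P.real B)
    exact ((div_lt_iff₀ hpos).1 hc).not_ge (hle c)
  filter_upwards [measure_eq_zero_iff_ae_notMem.1 hB] with ω hω
  simp only [B, Set.mem_ofPred_eq, not_forall, not_exists, not_lt] at hω
  obtain ⟨c, hc⟩ := hω
  exact ⟨c, hc⟩

theorem ae_eventually_mul_sq_iterate_le [IsProbabilityMeasure P] (hT : MeasurePreserving T P P)
    {Y : Ω → ℝ} (hYm : Measurable Y) (hY : MemLp Y 2 P) {c : ℝ} (hc : 0 ≤ c) :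
    ∀ᵐ ω ∂P, ∀ᶠ n : ℕ in atTop, c * Y (T^[n] ω) ^ 2 ≤ n := by
  let _ : MeasureSpace Ω := ⟨P⟩
  have : IsProbabilityMeasure (volume : Measure Ω) := ‹IsProbabilityMeasure P›
  have hmeas : ∀ n : ℕ, MeasurableSet {ω | (n : ℝ) < c * Y ω ^ 2} := fun n =>
    measurableSet_lt measurable_const ((hYm.pow_const 2).const_mul _)
  have htail : ∑' n : ℕ, P {ω | (n : ℝ) < c * Y (T^[n] ω) ^ 2} < ∞ := by
    refine (tsum_congr fun n => ?_).trans_lt (tsum_prob_mem_Ioi_lt_top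
      (X := fun ω => c * Y ω ^ 2) (hY.integrable_sq.const_mul _) fun ω => by positivity)
    exact (hT.iterate n).measure_preimage (hmeas n).nullMeasurableSet
  filter_upwards [ae_eventually_notMem htail.ne] with ω hω
  exact hω.mono fun n hn => not_lt.1 hn

theorem isLittleO_sqrt_of_eventually_mul_sq_le {y : ℕ → ℝ}
    (hy : ∀ c : ℕ, ∀ᶠ n : ℕ in atTop, c * y n ^ 2 ≤ n) :
    y =o[atTop] fun n : ℕ => √(n : ℝ) := by
  rw [Asymptotics.isLittleO_iff]
  intro ε hε
  obtain ⟨c, hc⟩ := exists_nat_gt ((ε ^ 2)⁻¹)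
  have hεc : 1 ≤ ε ^ 2 * c := ((inv_lt_iff_one_lt_mul₀' (by positivity)).1 hc).le
  filter_upwards [hy c] with n hn
  rw [Real.norm_eq_abs, Real.norm_of_nonneg (Real.sqrt_nonneg _)]
  refine abs_le_of_sq_le_sq ?_ (by positivity)
  rw [mul_pow, Real.sq_sqrt (Nat.cast_nonneg n)]
  calc y n ^ 2 ≤ (ε ^ 2 * c) * y n ^ 2 := le_mul_of_one_le_left (sq_nonneg _) hεc
    _ = ε ^ 2 * (c * y n ^ 2) := by ring
    _ ≤ ε ^ 2 * n := by gcongr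

theorem ae_iterate_isLittleO_sqrt [IsProbabilityMeasure P] (hT : MeasurePreserving T P P)
    {Y : Ω → ℝ} (hYm : Measurable Y) (hY : MemLp Y 2 P) :
    ∀ᵐ ω ∂P, (fun n => Y (T^[n] ω)) =o[atTop] fun n : ℕ => √(n : ℝ) := by
  filter_upwards [ae_all_iff.2 fun c : ℕ =>
    ae_eventually_mul_sq_iterate_le hT hYm hY (Nat.cast_nonneg c)] with ω hω
  exact isLittleO_sqrt_of_eventually_mul_sq_le hω

theorem exists_integrable_forall_sum_le {F : ℕ → Ω → ℝ} (hFm : ∀ i, Measurable (F i))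
    (hF₀ : ∀ i, 0 ≤ F i) (hF : ∀ i, Integrable (F i) P)
    (hsum : Summable fun i => ∫ ω, F i ω ∂P) :
    ∃ G : Ω → ℝ, Measurable G ∧ Integrable G P ∧ 0 ≤ G
      ∧ ∀ᵐ ω ∂P, ∀ J, ∑ i ∈ Finset.range J, F i ω ≤ G ω := by
  set G : Ω → ℝ≥0∞ := fun ω => ∑' i, ENNReal.ofReal (F i ω)
  have hGm : Measurable G := Measurable.tsum fun i => (hFm i).ennreal_ofReal
  have hG : ∫⁻ ω, G ω ∂P ≠ ∞ := by
    rw [lintegral_tsum fun i => (hFm i).ennreal_ofReal.aemeasurable,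
      tsum_congr fun i => (ofReal_integral_eq_lintegral_ofReal (hF i) (.of_forall (hF₀ i))).symm]
    exact hsum.tsum_ofReal_ne_top
  refine ⟨fun ω => (G ω).toReal, hGm.ennreal_toReal,
    integrable_toReal_of_lintegral_ne_top hGm.aemeasurable hG, fun ω => ENNReal.toReal_nonneg, ?_⟩
  filter_upwards [ae_lt_top hGm hG] with ω hω J
  rw [← ENNReal.ofReal_le_iff_le_toReal hω.ne, ENNReal.ofReal_sum_of_nonneg fun i _ => hF₀ i ω]
  exact ENNReal.sum_le_tsum _

theorem ae_birkhoffSum_isLittleO_sqrt [IsProbabilityMeasure P] (hT : MeasurePreserving T P P)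
    {Y : Ω → ℝ} (hYm : Measurable Y) (hY : MemLp Y 2 P) {β : ℕ → ℝ} (hβ : ∀ i, 0 < β i)
    (hβs : Summable fun i => (β i)⁻¹)
    (hsum : Summable fun i => β i * ((2 ^ i)⁻¹ * ∫ ω, birkhoffSum T Y (2 ^ i) ω ^ 2 ∂P)) :
    ∀ᵐ ω ∂P, (fun n => birkhoffSum T Y n ω) =o[atTop] fun n : ℕ => √(n : ℝ) := by
  obtain ⟨G, hGm, hG, hG₀, hFG⟩ := exists_integrable_forall_sum_le (P := P)
    (F := fun i ω => β i * ((2 ^ i)⁻¹ * birkhoffSum T Y (2 ^ i) ω ^ 2))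
    (fun i => (((measurable_birkhoffSum hT.measurable hYm _).pow_const 2).const_mul _).const_mul _)
    (fun i ω => mul_nonneg (hβ i).le (by positivity))
    (fun i => ((memLp_birkhoffSum hT hY _).integrable_sq.const_mul _).const_mul _)
    (by simpa only [integral_const_mul] using hsum)
  have hFG_iterate : ∀ᵐ ω ∂P, ∀ p J, ∑ i ∈ Finset.range J,
      β i * ((2 ^ i)⁻¹ * birkhoffSum T Y (2 ^ i) (T^[p] ω) ^ 2) ≤ G (T^[p] ω) :=
    ae_all_iff.2 fun p => (hT.iterate p).quasiMeasurePreserving.ae hFG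
  filter_upwards [hFG_iterate, ae_exists_birkhoffSum_le hT hGm hG hG₀,
    ae_iterate_isLittleO_sqrt hT hYm hY] with ω hω ⟨C, hC⟩ hsmall
  have hmajorant : IsDyadicMajorant β (fun n => Y (T^[n] ω)) (fun p => G (T^[p] ω)) := by
    intro p J
    refine (Finset.sum_le_sum fun i _ => le_of_eq ?_).trans (hω p J)
    rw [dyadicAvg_iterate]
    field_simp
  exact hmajorant.sum_isLittleO_sqrt hβ hβs hC hsmall

end MaximalErgodic

section Rates

theorem summable_of_eventually_contraction {u v : ℕ → ℝ} {ρ : ℝ} (hρ : ρ < 1) (hu : ∀ n, 0 ≤ u n)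
    (hv : Summable v) (hv₀ : ∀ n, 0 ≤ v n) (h : ∀ᶠ n in atTop, u (n + 1) ≤ ρ * u n + v n) :
    Summable u := by
  obtain ⟨N, hN⟩ := eventually_atTop.1 h
  rw [← summable_nat_add_iff N]
  refine summable_of_sum_range_le (c := (1 - ρ)⁻¹ * (u N + ∑' n, v (n + N)))
    (fun n => hu _) fun n => ?_
  rw [le_inv_mul_iff₀ (sub_pos.2 hρ)]
  have hstep : ∑ k ∈ Finset.range n, u (k + 1 + N)
      ≤ ρ * ∑ k ∈ Finset.range n, u (k + N) + ∑ k ∈ Finset.range n, v (k + N) := by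
    rw [Finset.mul_sum, ← Finset.sum_add_distrib]
    refine Finset.sum_le_sum fun k _ => ?_
    rw [add_right_comm]
    exact hN _ (Nat.le_add_left _ _)
  have hvN : ∑ k ∈ Finset.range n, v (k + N) ≤ ∑' n, v (n + N) :=
    ((summable_nat_add_iff N).2 hv).sum_le_tsum _ fun k _ => hv₀ _
  have hshift := Finset.sum_range_succ (fun k => u (k + N)) n
  rw [Finset.sum_range_succ', zero_add] at hshift
  linarith [hu (n + N)]

theorem sum_range_sum_Ico_two_pow (f : ℕ → ℝ) (J N : ℕ) :
    ∑ i ∈ Finset.range N, ∑ n ∈ Finset.Ico (2 ^ (i + J)) (2 ^ (i + J + 1)), f n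
      = ∑ n ∈ Finset.Ico (2 ^ J) (2 ^ (N + J)), f n := by
  induction N with
  | zero => simp
  | succ N ih =>
    rw [Finset.sum_range_succ, ih, add_right_comm N 1 J, Finset.sum_Ico_consecutive f
      (Nat.pow_le_pow_right two_pos (Nat.le_add_left _ _))
      (Nat.pow_le_pow_right two_pos (Nat.le_succ _))]

section Weights

variable {b : ℕ → ℝ}

theorem summable_inv_two_pow_iff (hpos : ∀ n, 1 ≤ n → 0 < b n)
    (hmono : MonotoneOn b (Set.Ici 1)) :
    (Summable fun J : ℕ => (b (2 ^ J))⁻¹) ↔ Summable fun n : ℕ => ((n : ℝ) * b n)⁻¹ := by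
  rw [← summable_condensed_iff_of_nonneg (f := fun n : ℕ => ((n : ℝ) * b n)⁻¹)
    (fun n => ?_) fun m n hm hmn => ?_]
  · refine summable_congr fun J => ?_
    push_cast
    rw [mul_inv, mul_inv_cancel_left₀ (by positivity)]
  · rcases Nat.eq_zero_or_pos n with rfl | hn
    · simp
    · have := hpos n hn
      positivity
  · have hbm := hpos m hm
    have hbmn := hmono hm (hm.trans_le hmn : 1 ≤ n) hmn
    have : (0 : ℝ) < m := by exact_mod_cast hm
    gcongr

theorem mul_sq_le_sum_Ico_two_pow (hpos : ∀ n, 1 ≤ n → 0 < b n)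
    (hmono : MonotoneOn b (Set.Ici 1)) {q : ℕ → ℝ} (hq₀ : ∀ n, 0 ≤ q n) (hq : Antitone q) (J : ℕ) :
    b (2 ^ J) * q (2 ^ (J + 1)) ^ 2 / 2
      ≤ ∑ n ∈ Finset.Ico (2 ^ J) (2 ^ (J + 1)),
          b (n + 1) / ((n + 1 : ℕ) : ℝ) * q (n + 1) ^ 2 := by
  have hterm : ∀ n ∈ Finset.Ico (2 ^ J) (2 ^ (J + 1)),
      b (2 ^ J) / 2 ^ (J + 1) * q (2 ^ (J + 1)) ^ 2
        ≤ b (n + 1) / ((n + 1 : ℕ) : ℝ) * q (n + 1) ^ 2 := by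
    intro n hn
    rw [Finset.mem_Ico] at hn
    have hden : ((n + 1 : ℕ) : ℝ) ≤ 2 ^ (J + 1) := by exact_mod_cast hn.2
    have hb : b (2 ^ J) ≤ b (n + 1) :=
      hmono (Nat.one_le_two_pow : 1 ≤ 2 ^ J) (Nat.le_add_left 1 n) (by omega)
    have hb₀ := hpos (n + 1) (Nat.le_add_left 1 n)
    have hqn := hq hn.2
    have hqJ := hq₀ (2 ^ (J + 1))
    gcongr
  have hcard : (Finset.Ico (2 ^ J) (2 ^ (J + 1))).card = 2 ^ J := by
    rw [Nat.card_Ico, pow_succ, mul_two, Nat.add_sub_cancel]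
  refine le_trans (le_of_eq ?_) (Finset.card_nsmul_le_sum _ _ _ hterm)
  rw [hcard, nsmul_eq_mul]
  push_cast
  field_simp
  ring

theorem AdmissibleWeights.monotoneOn (hb : AdmissibleWeights b) : MonotoneOn b (Set.Ici 1) :=
  fun m hm n _ hmn => hb.nondecreasing m n hm hmn

/-- The weights `b (2 ^ (J - 1))` at the dyadic scales. The shift by one makes them comparable with
blocks `2 ^ (J - 1), …, 2 ^ J - 1` on which a nondecreasing `b` is at least the weight. -/
def dyadicWeights (b : ℕ → ℝ) (J : ℕ) : ℝ := b (2 ^ (J - 1))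

theorem AdmissibleWeights.dyadicWeights_pos (hb : AdmissibleWeights b) (J : ℕ) :
    0 < dyadicWeights b J :=
  hb.pos _ Nat.one_le_two_pow

theorem AdmissibleWeights.summable_inv_dyadicWeights (hb : AdmissibleWeights b) :
    Summable fun J => (dyadicWeights b J)⁻¹ := by
  rw [← summable_nat_add_iff 1]
  refine (summable_inv_two_pow_iff hb.pos hb.monotoneOn).2 ?_
  rw [← summable_nat_add_iff 1]
  exact hb.summable

theorem AdmissibleWeights.eventually_dyadicWeights_succ_le (hb : AdmissibleWeights b) :
    ∀ᶠ J in atTop, dyadicWeights b (J + 1) ≤ 3 / 2 * dyadicWeights b J := by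
  have hlim : Tendsto (fun J : ℕ => b (2 ^ (J + 1)) / b (2 ^ J)) atTop (𝓝 1) := by
    refine ((hb.slowlyVarying 2 two_pos).comp
      (tendsto_pow_atTop_atTop_of_one_lt one_lt_two)).congr fun J => ?_
    have hfloor : ⌊2 * ((2 ^ J : ℕ) : ℝ)⌋₊ = 2 ^ (J + 1) := by
      rw [← Nat.floor_natCast (R := ℝ) (2 ^ (J + 1))]
      push_cast
      ring_nf
    rw [Function.comp_apply, hfloor]
  rw [← map_add_atTop_eq_nat 1, eventually_map]
  filter_upwards [hlim.eventually_lt_const (show (1 : ℝ) < 3 / 2 by norm_num)] with J hJ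
  exact ((div_lt_iff₀ (hb.pos _ Nat.one_le_two_pow)).1 hJ).le

theorem AdmissibleWeights.summable_dyadicWeights_mul_sq (hb : AdmissibleWeights b) {q : ℕ → ℝ}
    (hq₀ : ∀ n, 0 ≤ q n) (hq : Antitone q)
    (h : Summable fun n : ℕ => b (n + 1) / ((n + 1 : ℕ) : ℝ) * q (n + 1) ^ 2) :
    Summable fun J : ℕ => dyadicWeights b J * q (2 ^ J) ^ 2 := by
  rw [← summable_nat_add_iff 1]
  refine summable_of_sum_range_le
    (c := 2 * ∑' n : ℕ, b (n + 1) / ((n + 1 : ℕ) : ℝ) * q (n + 1) ^ 2)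
    (fun J => mul_nonneg (hb.dyadicWeights_pos _).le (sq_nonneg _)) fun N => ?_
  have hblocks := Finset.sum_le_sum (s := Finset.range N) fun J _ =>
    mul_sq_le_sum_Ico_two_pow hb.pos hb.monotoneOn hq₀ hq J
  have htsum := h.sum_le_tsum (Finset.Ico (2 ^ 0) (2 ^ (N + 0))) fun n _ =>
    mul_nonneg (div_nonneg (hb.pos _ (Nat.le_add_left 1 n)).le (Nat.cast_nonneg _)) (sq_nonneg _)
  rw [← Finset.sum_div] at hblocks
  rw [← sum_range_sum_Ico_two_pow] at htsum
  simp only [add_zero] at htsum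
  simp only [dyadicWeights, Nat.add_sub_cancel]
  linarith

end Weights

variable {a b : ℕ → ℝ}

/-- The tail `∑_{k ≥ n} a_k / k^{3/2}`, with `k = n + j`. -/
noncomputable def powerTail (a : ℕ → ℝ) (n : ℕ) : ℝ :=
  ∑' j : ℕ, a (n + j) / ((n + j : ℕ) : ℝ) ^ (3 / 2 : ℝ)

/-- The tail `∑_{i ≥ J} a (2 ^ i) / 2 ^ (i / 2)` over the dyadic scales. -/
noncomputable def dyadicTail (a : ℕ → ℝ) (J : ℕ) : ℝ :=
  ∑' i : ℕ, a (2 ^ (i + J)) / √(2 ^ (i + J))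

/-- The normalized sum `2 ^ (-J / 2) ∑_{i < J} a (2 ^ i)` over the dyadic scales. -/
noncomputable def dyadicHead (a : ℕ → ℝ) (J : ℕ) : ℝ :=
  (∑ i ∈ Finset.range J, a (2 ^ i)) / √(2 ^ J)

theorem summable_add_div_rpow (hs : Summable fun n : ℕ => a n / (n : ℝ) ^ (3 / 2 : ℝ)) (n : ℕ) :
    Summable fun j : ℕ => a (n + j) / ((n + j : ℕ) : ℝ) ^ (3 / 2 : ℝ) := by
  simpa only [add_comm] using (summable_nat_add_iff n).2 hs

theorem powerTail_nonneg (ha₀ : ∀ n, 0 ≤ a n) (n : ℕ) : 0 ≤ powerTail a n :=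
  tsum_nonneg fun _ => div_nonneg (ha₀ _) (by positivity)

theorem powerTail_antitone (ha₀ : ∀ n, 0 ≤ a n)
    (hs : Summable fun n : ℕ => a n / (n : ℝ) ^ (3 / 2 : ℝ)) : Antitone (powerTail a) := by
  intro m n hmn
  obtain ⟨k, rfl⟩ := Nat.exists_eq_add_of_le hmn
  rw [powerTail, powerTail, ← (summable_add_div_rpow hs m).sum_add_tsum_nat_add k]
  simp only [add_assoc, add_comm k]
  exact le_add_of_nonneg_left (Finset.sum_nonneg fun i _ => div_nonneg (ha₀ _) (by positivity))

theorem sum_Ico_le_powerTail (ha₀ : ∀ n, 0 ≤ a n)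
    (hs : Summable fun n : ℕ => a n / (n : ℝ) ^ (3 / 2 : ℝ)) (m n : ℕ) :
    ∑ k ∈ Finset.Ico m n, a k / (k : ℝ) ^ (3 / 2 : ℝ) ≤ powerTail a m := by
  rw [Finset.sum_Ico_eq_sum_range]
  exact (summable_add_div_rpow hs m).sum_le_tsum _ fun j _ => div_nonneg (ha₀ _) (by positivity)

theorem mul_le_sum_Ico_of_le_add (ha₀ : ∀ n, 0 ≤ a n) (ha : ∀ m n, a m ≤ a n + a (n + m)) (m : ℕ) :
    m * a m ≤ ∑ n ∈ Finset.Ico m (4 * m), a n := by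
  calc (m : ℝ) * a m = ∑ _n ∈ Finset.Ico m (2 * m), a m := by
        rw [Finset.sum_const, Nat.card_Ico, nsmul_eq_mul, show 2 * m - m = m by omega]
    _ ≤ ∑ n ∈ Finset.Ico m (2 * m), (a n + a (n + m)) := Finset.sum_le_sum fun n _ => ha m n
    _ = ∑ n ∈ Finset.Ico m (3 * m), a n := by
        rw [Finset.sum_add_distrib, Finset.sum_Ico_add' a m (2 * m) m, ← two_mul,
          Finset.sum_Ico_consecutive a (by omega) (by omega), show 2 * m + m = 3 * m by omega]
    _ ≤ ∑ n ∈ Finset.Ico m (4 * m), a n :=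
        Finset.sum_le_sum_of_subset_of_nonneg (Finset.Ico_subset_Ico_right (by omega))
          fun n _ _ => ha₀ n

theorem rpow_three_halves_le {m n : ℕ} (h : n ≤ 4 * m) :
    (n : ℝ) ^ (3 / 2 : ℝ) ≤ 8 * (m * √m) := by
  calc (n : ℝ) ^ (3 / 2 : ℝ) ≤ (4 * m : ℝ) ^ (3 / 2 : ℝ) :=
        Real.rpow_le_rpow n.cast_nonneg (by exact_mod_cast h) (by norm_num)
    _ = 8 * (m * √m) := by
        rw [show (3 / 2 : ℝ) = 1 + 1 / 2 by norm_num,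
          Real.rpow_add_of_nonneg (by positivity) (by norm_num) (by norm_num),
          Real.rpow_one, ← Real.sqrt_eq_rpow, Real.sqrt_mul (by norm_num),
          show (4 : ℝ) = 2 ^ 2 by norm_num, Real.sqrt_sq (by norm_num)]
        ring

theorem le_sqrt_mul_sum_Ico (ha₀ : ∀ n, 0 ≤ a n) (ha : ∀ m n, a m ≤ a n + a (n + m))
    {m : ℕ} (hm : 1 ≤ m) :
    a m ≤ 8 * √m * ∑ n ∈ Finset.Ico m (4 * m), a n / (n : ℝ) ^ (3 / 2 : ℝ) := by
  have hterm : ∀ n ∈ Finset.Ico m (4 * m),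
      a n ≤ 8 * (m * √m) * (a n / (n : ℝ) ^ (3 / 2 : ℝ)) := by
    intro n hn
    rw [Finset.mem_Ico] at hn
    have hn₀ : (0 : ℝ) < n := by exact_mod_cast hm.trans hn.1
    rw [mul_div_assoc', le_div_iff₀ (by positivity), mul_comm]
    exact mul_le_mul_of_nonneg_right (rpow_three_halves_le hn.2.le) (ha₀ n)
  have hsum := (mul_le_sum_Ico_of_le_add ha₀ ha m).trans (Finset.sum_le_sum hterm)
  rw [← Finset.mul_sum] at hsum
  refine le_of_mul_le_mul_left (hsum.trans_eq ?_) (show (0 : ℝ) < m by exact_mod_cast hm)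
  ring

theorem div_sqrt_two_pow_le (ha₀ : ∀ n, 0 ≤ a n) (ha : ∀ m n, a m ≤ a n + a (n + m)) (i : ℕ) :
    a (2 ^ i) / √(2 ^ i)
      ≤ 8 * (∑ n ∈ Finset.Ico (2 ^ i) (2 ^ (i + 1)), a n / (n : ℝ) ^ (3 / 2 : ℝ)
        + ∑ n ∈ Finset.Ico (2 ^ (i + 1)) (2 ^ (i + 1 + 1)), a n / (n : ℝ) ^ (3 / 2 : ℝ)) := by
  have h := le_sqrt_mul_sum_Ico ha₀ ha (m := 2 ^ i) Nat.one_le_two_pow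
  rw [Finset.sum_Ico_consecutive _ (Nat.pow_le_pow_right two_pos (Nat.le_succ _))
    (Nat.pow_le_pow_right two_pos (Nat.le_succ _)), div_le_iff₀ (by positivity)]
  rw [show 4 * 2 ^ i = 2 ^ (i + 1 + 1) by ring] at h
  push_cast at h
  linarith

theorem sum_dyadic_le_powerTail (ha₀ : ∀ n, 0 ≤ a n) (ha : ∀ m n, a m ≤ a n + a (n + m))
    (hs : Summable fun n : ℕ => a n / (n : ℝ) ^ (3 / 2 : ℝ)) (J N : ℕ) :
    ∑ i ∈ Finset.range N, a (2 ^ (i + J)) / √(2 ^ (i + J)) ≤ 16 * powerTail a (2 ^ J) := by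
  have hblocks := Finset.sum_le_sum (s := Finset.range N) fun i _ =>
    div_sqrt_two_pow_le ha₀ ha (i + J)
  have hnext := sum_range_sum_Ico_two_pow (fun n => a n / (n : ℝ) ^ (3 / 2 : ℝ)) (J + 1) N
  simp only [← add_assoc] at hnext
  rw [← Finset.mul_sum, Finset.sum_add_distrib, sum_range_sum_Ico_two_pow, hnext] at hblocks
  have hantitone : powerTail a (2 ^ (J + 1)) ≤ powerTail a (2 ^ J) :=
    powerTail_antitone ha₀ hs (Nat.pow_le_pow_right two_pos (Nat.le_succ J))
  linarith [sum_Ico_le_powerTail ha₀ hs (2 ^ J) (2 ^ (N + J)),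
    sum_Ico_le_powerTail ha₀ hs (2 ^ (J + 1)) (2 ^ (N + J + 1))]

theorem summable_dyadic (ha₀ : ∀ n, 0 ≤ a n) (ha : ∀ m n, a m ≤ a n + a (n + m))
    (hs : Summable fun n : ℕ => a n / (n : ℝ) ^ (3 / 2 : ℝ)) :
    Summable fun i : ℕ => a (2 ^ i) / √(2 ^ i) :=
  summable_of_sum_range_le (fun i => div_nonneg (ha₀ _) (by positivity))
    fun N => sum_dyadic_le_powerTail ha₀ ha hs 0 N

theorem dyadicTail_nonneg (ha₀ : ∀ n, 0 ≤ a n) (J : ℕ) : 0 ≤ dyadicTail a J :=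
  tsum_nonneg fun _ => div_nonneg (ha₀ _) (by positivity)

theorem dyadicTail_le_powerTail (ha₀ : ∀ n, 0 ≤ a n) (ha : ∀ m n, a m ≤ a n + a (n + m))
    (hs : Summable fun n : ℕ => a n / (n : ℝ) ^ (3 / 2 : ℝ)) (J : ℕ) :
    dyadicTail a J ≤ 16 * powerTail a (2 ^ J) :=
  Real.tsum_le_of_sum_range_le (fun i => div_nonneg (ha₀ _) (by positivity))
    fun N => sum_dyadic_le_powerTail ha₀ ha hs J N

theorem div_sqrt_two_pow_le_dyadicTail (ha₀ : ∀ n, 0 ≤ a n)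
    (hs : Summable fun i : ℕ => a (2 ^ i) / √(2 ^ i)) (J : ℕ) :
    a (2 ^ J) / √(2 ^ J) ≤ dyadicTail a J := by
  simpa only [dyadicTail, zero_add] using
    ((summable_nat_add_iff J).2 hs).le_tsum 0 fun i _ => div_nonneg (ha₀ _) (by positivity)

theorem sq_dyadicHead_succ (a : ℕ → ℝ) (J : ℕ) :
    dyadicHead a (J + 1) ^ 2 = (dyadicHead a J + a (2 ^ J) / √(2 ^ J)) ^ 2 / 2 := by
  rw [dyadicHead, dyadicHead, Finset.sum_range_succ, ← add_div, div_pow, div_pow,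
    Real.sq_sqrt (by positivity), Real.sq_sqrt (by positivity), pow_succ (2 : ℝ), div_div]

theorem AdmissibleWeights.summable_dyadicWeights_mul_sq_dyadicTail (hb : AdmissibleWeights b)
    (ha₀ : ∀ n, 0 ≤ a n) (ha : ∀ m n, a m ≤ a n + a (n + m))
    (hs : Summable fun n : ℕ => a n / (n : ℝ) ^ (3 / 2 : ℝ))
    (hsum : Summable fun n : ℕ => b (n + 1) / ((n + 1 : ℕ) : ℝ) * powerTail a (n + 1) ^ 2) :
    Summable fun J => dyadicWeights b J * dyadicTail a J ^ 2 := by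
  refine ((hb.summable_dyadicWeights_mul_sq (powerTail_nonneg ha₀) (powerTail_antitone ha₀ hs)
    hsum).mul_left 256).of_nonneg_of_le
    (fun J => mul_nonneg (hb.dyadicWeights_pos J).le (sq_nonneg _)) fun J => ?_
  calc dyadicWeights b J * dyadicTail a J ^ 2
      ≤ dyadicWeights b J * (16 * powerTail a (2 ^ J)) ^ 2 := by
        have := (hb.dyadicWeights_pos J).le
        have := dyadicTail_nonneg ha₀ J
        gcongr
        exact dyadicTail_le_powerTail ha₀ ha hs J
    _ = 256 * (dyadicWeights b J * powerTail a (2 ^ J) ^ 2) := by ring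

/-- The recursion `head_{J+1} = (head_J + a (2 ^ J) / √(2 ^ J)) / √2` halves the squares while the
weights grow by a factor of at most `3 / 2`, so the weighted squares are eventually contracted. -/
theorem AdmissibleWeights.summable_dyadicWeights_mul_sq_dyadicHead (hb : AdmissibleWeights b)
    (ha₀ : ∀ n, 0 ≤ a n) (hs : Summable fun i : ℕ => a (2 ^ i) / √(2 ^ i))
    (htail : Summable fun J => dyadicWeights b J * dyadicTail a J ^ 2) :
    Summable fun J => dyadicWeights b J * dyadicHead a J ^ 2 := by
  have hnonneg : ∀ (y : ℕ → ℝ) J, 0 ≤ dyadicWeights b J * y J ^ 2 := fun y J =>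
    mul_nonneg (hb.dyadicWeights_pos J).le (sq_nonneg _)
  refine summable_of_eventually_contraction (ρ := 27 / 32) (by norm_num) (hnonneg _)
    (htail.mul_left (27 / 4)) (fun J => mul_nonneg (by norm_num) (hnonneg _ J)) ?_
  filter_upwards [hb.eventually_dyadicWeights_succ_le] with J hJ
  have hsq : (dyadicHead a J + a (2 ^ J) / √(2 ^ J)) ^ 2
      ≤ 9 / 8 * dyadicHead a J ^ 2 + 9 * dyadicTail a J ^ 2 := by
    have hterm : (a (2 ^ J) / √(2 ^ J)) ^ 2 ≤ dyadicTail a J ^ 2 :=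
      pow_le_pow_left₀ (div_nonneg (ha₀ _) (by positivity))
        (div_sqrt_two_pow_le_dyadicTail ha₀ hs J) 2
    nlinarith [sq_nonneg (dyadicHead a J - 8 * (a (2 ^ J) / √(2 ^ J)))]
  rw [sq_dyadicHead_succ]
  calc dyadicWeights b (J + 1) * ((dyadicHead a J + a (2 ^ J) / √(2 ^ J)) ^ 2 / 2)
      ≤ (3 / 2 * dyadicWeights b J)
          * ((9 / 8 * dyadicHead a J ^ 2 + 9 * dyadicTail a J ^ 2) / 2) := by
        have := (hb.dyadicWeights_pos J).le
        gcongr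
    _ = _ := by ring

theorem AdmissibleWeights.summable_dyadicWeights_mul_sq_of_le (hb : AdmissibleWeights b)
    (ha₀ : ∀ n, 0 ≤ a n) (ha : ∀ m n, a m ≤ a n + a (n + m))
    (hs : Summable fun n : ℕ => a n / (n : ℝ) ^ (3 / 2 : ℝ))
    (hsum : Summable fun n : ℕ => b (n + 1) / ((n + 1 : ℕ) : ℝ) * powerTail a (n + 1) ^ 2)
    {r : ℕ → ℝ} (hr₀ : ∀ J, 0 ≤ r J)
    (hr : ∀ J, r J ≤ ∑ i ∈ Finset.range J, a (2 ^ i) + √(2 ^ J) * dyadicTail a J + a (2 ^ J)) :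
    Summable fun J => dyadicWeights b J * ((2 ^ J)⁻¹ * r J ^ 2) := by
  have hdyadic := summable_dyadic ha₀ ha hs
  have htail := hb.summable_dyadicWeights_mul_sq_dyadicTail ha₀ ha hs hsum
  have hhead := hb.summable_dyadicWeights_mul_sq_dyadicHead ha₀ hdyadic htail
  refine ((hhead.mul_left 2).add (htail.mul_left 8)).of_nonneg_of_le
    (fun J => mul_nonneg (hb.dyadicWeights_pos J).le (by positivity)) fun J => ?_
  have hsqrt : (0 : ℝ) < √(2 ^ J) := by positivity
  have hnormalized : r J / √(2 ^ J) ≤ dyadicHead a J + 2 * dyadicTail a J := by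
    have hsplit : r J / √(2 ^ J) ≤ dyadicHead a J + dyadicTail a J + a (2 ^ J) / √(2 ^ J) := by
      rw [div_le_iff₀ hsqrt, dyadicHead]
      refine (hr J).trans_eq ?_
      field_simp
    linarith [div_sqrt_two_pow_le_dyadicTail ha₀ hdyadic J]
  have hsq : (2 ^ J)⁻¹ * r J ^ 2 ≤ 2 * dyadicHead a J ^ 2 + 8 * dyadicTail a J ^ 2 := by
    have hpow := pow_le_pow_left₀ (div_nonneg (hr₀ J) hsqrt.le) hnormalized 2
    rw [div_pow, Real.sq_sqrt (by positivity), div_eq_inv_mul] at hpow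
    nlinarith [sq_nonneg (dyadicHead a J - 2 * dyadicTail a J)]
  linarith [mul_le_mul_of_nonneg_left hsq (hb.dyadicWeights_pos J).le]

end Rates

section LogWeights

theorem one_lt_log_of_three_le {x : ℝ} (hx : 3 ≤ x) : 1 < Real.log x := by
  rw [Real.lt_log_iff_exp_lt (by linarith)]
  linarith [Real.exp_one_lt_d9]

theorem log₂_of_three_le {x : ℝ} (hx : 3 ≤ x) : log₂ x = Real.log (Real.log x) := by
  rw [log₂, max_eq_right]
  linarith [Real.exp_one_lt_d9]

theorem three_le_natCast_max (n : ℕ) : (3 : ℝ) ≤ ((max n 3 : ℕ) : ℝ) := by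
  exact_mod_cast le_max_right n 3

theorem log_log_natCast_max_pos (n : ℕ) : 0 < Real.log (Real.log ((max n 3 : ℕ) : ℝ)) :=
  Real.log_pos (one_lt_log_of_three_le (three_le_natCast_max n))

theorem logWeights_eq (γ : ℝ) (n : ℕ) : logWeights γ n
    = Real.log ((max n 3 : ℕ) : ℝ) * Real.log (Real.log ((max n 3 : ℕ) : ℝ)) ^ γ := by
  rw [logWeights, log₂_of_three_le (three_le_natCast_max n)]

theorem logWeights_pos (γ : ℝ) (n : ℕ) : 0 < logWeights γ n := by
  rw [logWeights_eq]
  exact mul_pos (one_pos.trans (one_lt_log_of_three_le (three_le_natCast_max n)))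
    (Real.rpow_pos_of_pos (log_log_natCast_max_pos n) _)

theorem logWeights_mono {γ : ℝ} (hγ : 0 ≤ γ) : Monotone (logWeights γ) := by
  intro m n hmn
  have hlog_one := one_lt_log_of_three_le (three_le_natCast_max m)
  have hmax : ((max m 3 : ℕ) : ℝ) ≤ ((max n 3 : ℕ) : ℝ) := by
    exact_mod_cast max_le_max hmn le_rfl
  have hlog := Real.log_le_log (by linarith [three_le_natCast_max m]) hmax
  have hloglog := Real.log_le_log (by linarith) hlog
  have hpos := log_log_natCast_max_pos m
  rw [logWeights_eq, logWeights_eq]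
  gcongr

theorem tendsto_log_div_log {u v : ℕ → ℝ} {c : ℝ} (hc : 0 < c) (hv : Tendsto v atTop atTop)
    (huv : Tendsto (fun n => u n / v n) atTop (𝓝 c)) :
    Tendsto (fun n => Real.log (u n) / Real.log (v n)) atTop (𝓝 1) := by
  have hlim : Tendsto (fun n => 1 + Real.log (u n / v n) / Real.log (v n)) atTop (𝓝 (1 + 0)) :=
    tendsto_const_nhds.add (((Real.continuousAt_log hc.ne').tendsto.comp huv).div_atTop
      (Real.tendsto_log_atTop.comp hv))
  rw [add_zero] at hlim
  refine hlim.congr' ?_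
  filter_upwards [huv.eventually_const_lt hc, hv.eventually_gt_atTop 1] with n hquot hvn
  have hv₀ : 0 < v n := one_pos.trans hvn
  have hu₀ : 0 < u n := (div_pos_iff_of_pos_right hv₀).1 hquot
  have hlog : Real.log (v n) ≠ 0 := (Real.log_pos hvn).ne'
  rw [Real.log_div hu₀.ne' hv₀.ne', sub_div, div_self hlog, add_sub_cancel]

theorem tendsto_natCast_max_floor_mul_div {l : ℝ} (hl : 0 < l) (m : ℕ) :
    Tendsto (fun n : ℕ => ((max ⌊l * (n : ℝ)⌋₊ m : ℕ) : ℝ) / ((max n m : ℕ) : ℝ)) atTop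
      (𝓝 l) := by
  refine ((tendsto_nat_floor_mul_div_atTop hl.le).comp
    (tendsto_natCast_atTop_atTop (R := ℝ))).congr' ?_
  have hfloor : Tendsto (fun n : ℕ => ⌊l * (n : ℝ)⌋₊) atTop atTop :=
    tendsto_nat_floor_atTop.comp (tendsto_natCast_atTop_atTop.const_mul_atTop hl)
  filter_upwards [eventually_ge_atTop m, hfloor.eventually_ge_atTop m] with n hn hln
  rw [Function.comp_apply, max_eq_left hn, max_eq_left hln]

theorem slowlyVarying_logWeights (γ : ℝ) : SlowlyVarying (logWeights γ) := by
  intro l hl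
  have hmax : Tendsto (fun n : ℕ => ((max n 3 : ℕ) : ℝ)) atTop atTop :=
    tendsto_natCast_atTop_atTop.comp (tendsto_atTop_mono (fun n => le_max_left n 3) tendsto_id)
  have hlog := tendsto_log_div_log hl hmax (tendsto_natCast_max_floor_mul_div hl 3)
  have hloglog := tendsto_log_div_log one_pos (Real.tendsto_log_atTop.comp hmax) hlog
  have hprod := hlog.mul (hloglog.rpow_const (p := γ) (Or.inl one_ne_zero))
  rw [Real.one_rpow, mul_one] at hprod
  refine hprod.congr fun n => ?_
  rw [logWeights_eq, logWeights_eq, mul_div_mul_comm,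
    ← Real.div_rpow (log_log_natCast_max_pos _).le (log_log_natCast_max_pos n).le]
  rfl

theorem le_log_log_two_pow_two_pow (k : ℕ) :
    Real.log 2 / 2 * ((k + 2 : ℕ) : ℝ) ≤ Real.log (2 ^ (k + 2) * Real.log 2) := by
  have hlog_two : 1 / 2 < Real.log 2 := by linarith [Real.log_two_gt_d9]
  have hlog_log_two : -Real.log 2 ≤ Real.log (Real.log 2) := by
    rw [← Real.log_inv]
    exact Real.log_le_log (by norm_num) (by linarith)
  have hk : 0 ≤ (k : ℝ) * Real.log 2 := by positivity
  rw [Real.log_mul (by positivity) (by positivity), Real.log_pow]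
  push_cast
  linarith

theorem le_logWeights_two_pow_two_pow {γ : ℝ} (hγ : 0 ≤ γ) (k : ℕ) :
    2 ^ (k + 2) * (Real.log 2 * ((Real.log 2 / 2) ^ γ * ((k + 2 : ℕ) : ℝ) ^ γ))
      ≤ logWeights γ (2 ^ 2 ^ (k + 2)) := by
  have hthree : 3 ≤ 2 ^ 2 ^ (k + 2) :=
    calc 3 ≤ 2 ^ 2 ^ 1 := by norm_num
      _ ≤ 2 ^ 2 ^ (k + 2) := Nat.pow_le_pow_right two_pos
          (Nat.pow_le_pow_right two_pos (Nat.le_add_left 1 (k + 1)))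
  have hlog : Real.log ((2 ^ 2 ^ (k + 2) : ℕ) : ℝ) = 2 ^ (k + 2) * Real.log 2 := by
    push_cast
    rw [Real.log_pow]
    push_cast
    rfl
  rw [logWeights_eq, max_eq_left hthree, hlog, mul_assoc,
    ← Real.mul_rpow (by positivity) (by positivity)]
  gcongr
  exact le_log_log_two_pow_two_pow k

theorem summable_inv_logWeights {γ : ℝ} (hγ : 1 < γ) :
    Summable fun n : ℕ => ((n : ℝ) * logWeights γ n)⁻¹ := by
  have hγ₀ : 0 ≤ γ := by linarith
  have hpos : ∀ k, 0 < logWeights γ (2 ^ k) := fun k => logWeights_pos γ _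
  rw [← summable_inv_two_pow_iff (fun n _ => logWeights_pos γ n)
    ((logWeights_mono hγ₀).monotoneOn _)]
  refine (summable_condensed_iff_of_nonneg (f := fun k => (logWeights γ (2 ^ k))⁻¹)
    (fun k => (inv_pos.2 (hpos k)).le) fun m n _ hmn => ?_).1 ?_
  · exact inv_anti₀ (hpos m) (logWeights_mono hγ₀ (Nat.pow_le_pow_right two_pos hmn))
  rw [← summable_nat_add_iff 2]
  refine Summable.of_nonneg_of_le (fun k => mul_nonneg (by positivity) (inv_pos.2 (hpos _)).le)
    (fun k => ?_) (((summable_nat_add_iff 2).2 (Real.summable_nat_rpow_inv.2 hγ)).mul_left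
      ((Real.log 2)⁻¹ * ((Real.log 2 / 2) ^ γ)⁻¹))
  calc (2 : ℝ) ^ (k + 2) * (logWeights γ (2 ^ 2 ^ (k + 2)))⁻¹
      ≤ 2 ^ (k + 2)
        * (2 ^ (k + 2) * (Real.log 2 * ((Real.log 2 / 2) ^ γ * ((k + 2 : ℕ) : ℝ) ^ γ)))⁻¹ := by
        gcongr
        exact le_logWeights_two_pow_two_pow hγ₀ k
    _ = (Real.log 2)⁻¹ * ((Real.log 2 / 2) ^ γ)⁻¹ * (((k + 2 : ℕ) : ℝ) ^ γ)⁻¹ := by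
        rw [mul_inv, mul_inv_cancel_left₀ (by positivity), mul_inv, mul_inv, mul_assoc]

theorem admissibleWeights_logWeights {γ : ℝ} (hγ : 1 < γ) : AdmissibleWeights (logWeights γ) where
  pos n _ := logWeights_pos γ n
  nondecreasing _ _ _ hmn := logWeights_mono (by linarith) hmn
  slowlyVarying := slowlyVarying_logWeights γ
  summable := (summable_nat_add_iff 1).2 (summable_inv_logWeights hγ)

end LogWeights

section CondExp

theorem condExp_comp_measurePreserving {Ω Ω' E : Type*} {m' : MeasurableSpace Ω'}
    [mΩ : MeasurableSpace Ω] [mΩ' : MeasurableSpace Ω'] {P : Measure Ω} {P' : Measure Ω'}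
    [NormedAddCommGroup E] [NormedSpace ℝ E] [CompleteSpace E] [IsFiniteMeasure P] {φ : Ω → Ω'}
    (hφ : MeasurePreserving φ P P') (hm : m' ≤ mΩ') {f : Ω' → E} (hf : Integrable f P') :
    P[f ∘ φ | m'.comap φ] =ᵐ[P] P'[f | m'] ∘ φ := by
  have : IsFiniteMeasure P' := hφ.map_eq ▸ inferInstance
  have hcomap : m'.comap φ ≤ mΩ := (MeasurableSpace.comap_mono hm).trans hφ.measurable.comap_le
  have hpreimage : ∀ {g : Ω' → E}, Integrable g P' → ∀ t, MeasurableSet[m'] t →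
      ∫ ω in φ ⁻¹' t, g (φ ω) ∂P = ∫ ω in t, g ω ∂P' := by
    intro g hg t ht
    have hg_meas := hg.aestronglyMeasurable
    rw [← hφ.map_eq] at hg_meas ⊢
    exact (setIntegral_map (hm t ht) hg_meas hφ.measurable.aemeasurable).symm
  refine (ae_eq_condExp_of_forall_setIntegral_eq hcomap
    (hφ.integrable_comp_of_integrable hf) (fun s _ _ => ?_) ?_ ?_).symm
  · exact (hφ.integrable_comp_of_integrable integrable_condExp).integrableOn
  · rintro s ⟨t, ht, rfl⟩ -
    refine (hpreimage integrable_condExp t ht).trans ?_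
    rw [setIntegral_condExp hm hf ht]
    exact (hpreimage hf t ht).symm
  · exact (stronglyMeasurable_condExp.comp_measurable
      (comap_measurable φ)).aestronglyMeasurable

theorem martingale_partialSum {Ω : Type*} {mΩ : MeasurableSpace Ω} {P : Measure Ω}
    [IsFiniteMeasure P] {F : Filtration ℤ mΩ} {D : ℤ → Ω → ℝ}
    (hint : ∀ k : ℤ, Integrable (D k) P) (hmeas : ∀ k : ℤ, StronglyMeasurable[F (k + 1)] (D k))
    (hzero : ∀ k : ℤ, P[D k | F k] =ᵐ[P] 0) :
    Martingale (partialSum D) (natFiltration F) P := by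
  refine martingale_of_condExp_sub_eq_zero_nat (fun n => ?_) (fun n => ?_) fun n => ?_
  · refine Finset.stronglyMeasurable_fun_sum _ fun i hi => (hmeas i).mono (F.mono ?_)
    have := Finset.mem_range.1 hi
    omega
  · exact integrable_finsetSum _ fun i _ => hint i
  · have hincrement : partialSum D (n + 1) - partialSum D n = D n := by
      funext ω
      simp [partialSum, Finset.sum_range_succ]
    rw [hincrement]
    exact hzero n

end CondExp

section Iterates

variable {Ω : Type*} [MeasurableSpace Ω] {P : Measure Ω} {T : Ω ≃ᵐ Ω}

theorem iter_zero (T : Ω ≃ᵐ Ω) : iter T 0 = id := by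
  simp only [iter, zpow_zero]; rfl

theorem iter_add (T : Ω ≃ᵐ Ω) (i j : ℤ) : iter T (i + j) = iter T i ∘ iter T j := by
  simp only [iter, zpow_add]; rfl

theorem iter_sub_one (T : Ω ≃ᵐ Ω) (i : ℤ) : iter T (i - 1) = T.symm ∘ iter T i := by
  conv_rhs => rw [← sub_add_cancel i 1, iter_add_one]
  funext ω
  simp

theorem iter_natCast (T : Ω ≃ᵐ Ω) (n : ℕ) : iter T n = T^[n] := by
  simp only [iter, zpow_natCast]
  exact (Equiv.Perm.iterate_eq_pow _ _).symm

theorem measurePreserving_iter (hT : MeasurePreserving T P P) (i : ℤ) :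
    MeasurePreserving (iter T i) P P := by
  induction i using Int.induction_on with
  | zero => rw [iter_zero]; exact MeasurePreserving.id P
  | succ n ih => rw [iter_add_one]; exact hT.comp ih
  | pred n ih => rw [iter_sub_one]; exact (hT.symm T).comp ih

theorem partialSum_iter (f : Ω → ℝ) (n : ℕ) :
    partialSum (fun i ω => f (iter T i ω)) n = birkhoffSum T f n := by
  funext ω
  simp only [partialSum, birkhoffSum, iter_natCast]

theorem isStationary_iter {S : Type*} [MeasurableSpace S] (hT : MeasurePreserving T P P)
    {f : Ω → S} (hf : Measurable f) : IsStationary (fun k ω => f (iter T k ω)) P := by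
  intro k
  have hprocess : Measurable fun ω (i : ℤ) => f (iter T i ω) :=
    measurable_pi_lambda _ fun i => hf.comp (measurable_iter T i)
  have hshift : (fun ω (i : ℤ) => f (iter T (i + k) ω))
      = (fun ω (i : ℤ) => f (iter T i ω)) ∘ iter T k := by
    funext ω i
    simp only [iter_add, Function.comp]
  refine ⟨?_, hprocess.aemeasurable, ?_⟩
  · rw [hshift]
    exact (hprocess.comp (measurable_iter T k)).aemeasurable
  · rw [hshift, ← Measure.map_map hprocess (measurable_iter T k),
      (measurePreserving_iter hT k).map_eq]

end Iterates

section Koopman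

variable (𝕜 : Type*) [RCLike 𝕜] {Ω : Type*} {F₀ : MeasurableSpace Ω} [mΩ : MeasurableSpace Ω]
  {P : Measure Ω}

/-- The Koopman operator `f ↦ f ∘ T` of a measure preserving map, as an isometry of `L²`. -/
noncomputable abbrev koopman {T : Ω → Ω} (hT : MeasurePreserving T P P) :
    Lp 𝕜 2 P →ₗᵢ[𝕜] Lp 𝕜 2 P :=
  Lp.compMeasurePreservingₗᵢ 𝕜 T hT

theorem coeFn_koopman {T : Ω → Ω} (hT : MeasurePreserving T P P) (f : Lp 𝕜 2 P) :
    koopman 𝕜 hT f =ᵐ[P] f ∘ T :=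
  Lp.coeFn_compMeasurePreserving f hT

theorem lpMeas_le_map_koopman {T : Ω ≃ᵐ Ω} (hT : MeasurePreserving T P P) (hF : F₀ ≤ F₀.comap T) :
    lpMeas 𝕜 𝕜 F₀ 2 P ≤ (lpMeas 𝕜 𝕜 F₀ 2 P).map (koopman 𝕜 hT).toLinearMap := by
  intro z hz
  obtain ⟨g, hg, hzg⟩ := mem_lpMeas_iff_aestronglyMeasurable.1 hz
  have hT_symm : MeasurePreserving T.symm P P := hT.symm T
  have hmeas : Measurable[F₀, F₀.comap T] T.symm := by
    rintro s ⟨t, ht, rfl⟩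
    rwa [← Set.preimage_comp, MeasurableEquiv.self_comp_symm, Set.preimage_id]
  refine ⟨koopman 𝕜 hT_symm z, mem_lpMeas_iff_aestronglyMeasurable.2 ⟨g ∘ T.symm, ?_, ?_⟩, ?_⟩
  · exact (hg.mono hF).comp_measurable hmeas
  · exact (coeFn_koopman 𝕜 hT_symm z).trans (hT_symm.quasiMeasurePreserving.ae_eq_comp hzg)
  · refine Lp.ext ((coeFn_koopman 𝕜 hT _).trans ?_)
    filter_upwards [hT.quasiMeasurePreserving.ae_eq_comp (coeFn_koopman 𝕜 hT_symm z)] with ω hω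
    rw [hω]
    simp

variable {𝕜} {z : Lp 𝕜 2 P} {f : Ω → 𝕜}

theorem coeFn_powerSum_koopman {T : Ω → Ω} (hT : MeasurePreserving T P P) (hz : z =ᵐ[P] f)
    (n : ℕ) : powerSum (koopman 𝕜 hT).toContinuousLinearMap n z =ᵐ[P] birkhoffSum T f n := by
  induction n with
  | zero =>
    simp only [powerSum, Finset.range_zero, Finset.sum_empty, birkhoffSum_zero']
    exact Lp.coeFn_zero _ _ _
  | succ n ih =>
    set y := powerSum (koopman 𝕜 hT).toContinuousLinearMap n z
    have hsucc : powerSum (koopman 𝕜 hT).toContinuousLinearMap (n + 1) z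
        = z + koopman 𝕜 hT y := powerSum_succ_apply _ n z
    rw [hsucc]
    filter_upwards [Lp.coeFn_add z (koopman 𝕜 hT y), coeFn_koopman 𝕜 hT y, hz,
      hT.quasiMeasurePreserving.ae_eq_comp ih] with ω hadd hkoopman hzω hyω
    rw [hadd, Pi.add_apply, hkoopman, hzω, hyω, birkhoffSum_succ', Function.comp_apply]

theorem norm_sq_eq_integral_of_ae_eq (hz : z =ᵐ[P] f) : ‖z‖ ^ 2 = ∫ ω, ‖f ω‖ ^ 2 ∂P := by
  have hinner := inner_self_eq_norm_sq_to_K (𝕜 := 𝕜) z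
  rw [L2.inner_def] at hinner
  simp only [inner_self_eq_norm_sq_to_K, ← RCLike.ofReal_pow, integral_ofReal,
    RCLike.ofReal_inj] at hinner
  rw [← hinner]
  exact integral_congr_ae (hz.mono fun ω hω => congrArg (‖·‖ ^ 2) hω)

theorem coeFn_starProjection_lpMeas [IsFiniteMeasure P] (hF : F₀ ≤ mΩ)
    [(lpMeas 𝕜 𝕜 F₀ 2 P).HasOrthogonalProjection] (hz : z =ᵐ[P] f) :
    (lpMeas 𝕜 𝕜 F₀ 2 P).starProjection z =ᵐ[P] P[f | F₀] := by
  have hf : MemLp f 2 P := (memLp_congr_ae hz).1 (Lp.memLp z)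
  have hz' : hf.toLp f = z := Lp.ext (hf.coeFn_toLp.trans hz.symm)
  exact hz' ▸ hf.condExpL2_ae_eq_condExp (𝕜 := 𝕜) hF

theorem enorm_powerSum_compression_koopman [IsFiniteMeasure P] {T : Ω ≃ᵐ Ω}
    (hT : MeasurePreserving T P P) (hF₀ : F₀ ≤ mΩ) (hF : F₀ ≤ F₀.comap T)
    [(lpMeas 𝕜 𝕜 F₀ 2 P).HasOrthogonalProjection] (hz : z ∈ lpMeas 𝕜 𝕜 F₀ 2 P)
    (hzf : z =ᵐ[P] f) (n : ℕ) :
    ‖powerSum (compression (koopman 𝕜 hT) (lpMeas 𝕜 𝕜 F₀ 2 P)) n z‖ₑ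
      = eLpNorm (P[birkhoffSum T f n | F₀]) 2 P := by
  rw [← eLpNorm_congr_ae (coeFn_starProjection_lpMeas hF₀ (coeFn_powerSum_koopman hT hzf n)),
    starProjection_powerSum _ (lpMeas_le_map_koopman 𝕜 hT hF) hz, Lp.enorm_def]

theorem exists_of_mem_innovationSpace_koopman [IsFiniteMeasure P] {T : Ω ≃ᵐ Ω}
    (hT : MeasurePreserving T P P) (hF₀ : F₀ ≤ mΩ)
    (hz : z ∈ innovationSpace (koopman 𝕜 hT) (lpMeas 𝕜 𝕜 F₀ 2 P)) :
    ∃ g : Ω → 𝕜, StronglyMeasurable[F₀] g ∧ z =ᵐ[P] g ∘ T ∧ P[g ∘ T | F₀] =ᵐ[P] 0 := by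
  have : Fact (F₀ ≤ mΩ) := ⟨hF₀⟩
  obtain ⟨⟨y, hy, rfl⟩, horth⟩ := hz
  obtain ⟨g, hg, hyg⟩ := mem_lpMeas_iff_aestronglyMeasurable.1 hy
  have hyT : koopman 𝕜 hT y =ᵐ[P] g ∘ T :=
    (coeFn_koopman 𝕜 hT y).trans (hT.quasiMeasurePreserving.ae_eq_comp hyg)
  refine ⟨g, hg, hyT, (coeFn_starProjection_lpMeas hF₀ hyT).symm.trans ?_⟩
  have hproj : (lpMeas 𝕜 𝕜 F₀ 2 P).starProjection (koopman 𝕜 hT y) = 0 :=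
    (lpMeas 𝕜 𝕜 F₀ 2 P).starProjection_apply_eq_zero_iff.2 horth
  rw [hproj]
  exact Lp.coeFn_zero _ _ _

end Koopman

section SlowCondition

variable {Ω : Type*} {mΩ : MeasurableSpace Ω} {P : Measure Ω} {F : Filtration ℤ mΩ}
  {X : ℤ → Ω → ℝ} {a b : ℕ → ℝ}

theorem projTail_succ_eq_tsum_ofReal
    (ha : ∀ n, eLpNorm (P[partialSum X n | F 0]) 2 P = ENNReal.ofReal (a n)) (n : ℕ) :
    projTail P F X (n + 1)
      = ∑' j : ℕ, ENNReal.ofReal (a (n + 1 + j) / ((n + 1 + j : ℕ) : ℝ) ^ (3 / 2 : ℝ)) := by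
  refine tsum_congr fun j => ?_
  rw [ha, ENNReal.ofReal_div_of_pos (Real.rpow_pos_of_pos (Nat.cast_pos.2 (by lia)) _)]

theorem SlowCondition.projTail_succ_ne_top (h : SlowCondition P F X b) {n : ℕ}
    (hb : 0 < b (n + 1)) : projTail P F X (n + 1) ≠ ∞ := by
  intro htop
  have hweight : ENNReal.ofReal (b (n + 1) / ((n + 1 : ℕ) : ℝ)) ≠ 0 := by
    rw [Ne, ENNReal.ofReal_eq_zero, not_le]
    positivity
  refine ENNReal.ne_top_of_tsum_ne_top h.ne n ?_
  rw [htop, ENNReal.top_pow two_ne_zero, ENNReal.mul_top hweight]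

theorem SlowCondition.summable_div_rpow (h : SlowCondition P F X b) (hb : 0 < b 1)
    (ha₀ : ∀ n, 0 ≤ a n)
    (ha : ∀ n, eLpNorm (P[partialSum X n | F 0]) 2 P = ENNReal.ofReal (a n)) :
    Summable fun n : ℕ => a n / (n : ℝ) ^ (3 / 2 : ℝ) := by
  have hne_top := h.projTail_succ_ne_top (n := 0) hb
  rw [projTail_succ_eq_tsum_ofReal ha] at hne_top
  rw [← summable_nat_add_iff 1]
  refine (ENNReal.summable_toReal hne_top).congr fun j => ?_
  rw [ENNReal.toReal_ofReal (div_nonneg (ha₀ _) (by positivity)), zero_add, add_comm 1 j]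

theorem SlowCondition.summable_mul_sq_powerTail (h : SlowCondition P F X b)
    (hb : ∀ n, 0 < b (n + 1)) (ha₀ : ∀ n, 0 ≤ a n)
    (ha : ∀ n, eLpNorm (P[partialSum X n | F 0]) 2 P = ENNReal.ofReal (a n)) :
    Summable fun n : ℕ => b (n + 1) / ((n + 1 : ℕ) : ℝ) * powerTail a (n + 1) ^ 2 := by
  have hs := h.summable_div_rpow (hb 0) ha₀ ha
  refine (ENNReal.summable_toReal (LT.lt.ne h)).congr fun n => ?_
  have hterm : ∀ j : ℕ, 0 ≤ a (n + 1 + j) / ((n + 1 + j : ℕ) : ℝ) ^ (3 / 2 : ℝ) := fun j =>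
    div_nonneg (ha₀ _) (by positivity)
  rw [ENNReal.toReal_mul, ENNReal.toReal_pow,
    ENNReal.toReal_ofReal (div_nonneg (hb n).le (Nat.cast_nonneg _)),
    projTail_succ_eq_tsum_ofReal ha,
    ← ENNReal.ofReal_tsum_of_nonneg hterm (summable_add_div_rpow hs (n + 1)),
    ENNReal.toReal_ofReal (tsum_nonneg hterm), powerTail]

end SlowCondition

theorem AdmissibleWeights.summable_norm_powerSum_sub_innovationSeries {𝕜 H : Type*} [RCLike 𝕜]
    [NormedAddCommGroup H] [InnerProductSpace 𝕜 H] [CompleteSpace H] {b : ℕ → ℝ}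
    (hb : AdmissibleWeights b) (U : H →ₗᵢ[𝕜] H) {K : Submodule 𝕜 H} [K.HasOrthogonalProjection]
    (hK : K ≤ K.map U.toLinearMap) {x : H} (hx : x ∈ K)
    (hs : Summable fun n : ℕ => ‖powerSum (compression U K) n x‖ / (n : ℝ) ^ (3 / 2 : ℝ))
    (hsum : Summable fun n : ℕ => b (n + 1) / ((n + 1 : ℕ) : ℝ)
      * powerTail (fun k => ‖powerSum (compression U K) k x‖) (n + 1) ^ 2) :
    Summable fun J => dyadicWeights b J * ((2 ^ J)⁻¹
      * ‖powerSum U.toContinuousLinearMap (2 ^ J) (x - innovationSeries U K x)‖ ^ 2) := by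
  set a : ℕ → ℝ := fun n => ‖powerSum (compression U K) n x‖
  have ha₀ : ∀ n, 0 ≤ a n := fun n => norm_nonneg _
  have ha : ∀ m n, a m ≤ a n + a (n + m) := fun m n =>
    norm_powerSum_le_add (norm_compression_le_one U K) m n x
  have hdyadic : Summable fun i : ℕ => a (2 ^ i) / √(2 ^ i) := summable_dyadic ha₀ ha hs
  refine hb.summable_dyadicWeights_mul_sq_of_le ha₀ ha hs hsum (fun J => norm_nonneg _) fun J => ?_
  exact norm_powerSum_sub_innovationSeries_le U hK hx hdyadic J

section Transformation

variable {Ω : Type*} {F₀ : MeasurableSpace Ω} [mΩ : MeasurableSpace Ω] {P : Measure Ω}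
  [IsProbabilityMeasure P] {T : Ω ≃ᵐ Ω}

theorem shiftFiltration_zero (hF₀ : F₀ ≤ mΩ) (hT : F₀ ≤ F₀.comap T) :
    shiftFiltration F₀ T hF₀ hT 0 = F₀ := by
  change F₀.comap (iter T 0) = F₀
  rw [iter_zero, MeasurableSpace.comap_id]

theorem exists_birkhoffSum_sub_isLittleO_sqrt {b : ℕ → ℝ} (hb : AdmissibleWeights b)
    (hTP : MeasurePreserving T P P) (hF₀ : F₀ ≤ mΩ) (hT : F₀ ≤ F₀.comap T) {X₀ : Ω → ℝ}
    (hX₀ : Measurable[F₀] X₀) (hX₀_memLp : MemLp X₀ 2 P)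
    (hslow : SlowCondition P (shiftFiltration F₀ T hF₀ hT) (fun i ω => X₀ (iter T i ω)) b) :
    ∃ g : Ω → ℝ, StronglyMeasurable[F₀] g ∧ MemLp (g ∘ T) 2 P ∧ P[g ∘ T | F₀] =ᵐ[P] 0 ∧
      ∀ᵐ ω ∂P, (fun n => birkhoffSum T (X₀ - g ∘ T) n ω) =o[atTop] fun n : ℕ => √(n : ℝ) := by
  have : Fact (F₀ ≤ mΩ) := ⟨hF₀⟩
  set K := lpMeas ℝ ℝ F₀ 2 P
  set U := koopman ℝ hTP
  have hK : K ≤ K.map U.toLinearMap := lpMeas_le_map_koopman ℝ hTP hT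
  set x : Lp ℝ 2 P := hX₀_memLp.toLp X₀
  have hxX₀ : x =ᵐ[P] X₀ := hX₀_memLp.coeFn_toLp
  have hxK : x ∈ K := mem_lpMeas_iff_aestronglyMeasurable.2 ⟨X₀, hX₀.stronglyMeasurable, hxX₀⟩
  have hnorm : ∀ n, eLpNorm (P[partialSum (fun i ω => X₀ (iter T i ω)) n |
      shiftFiltration F₀ T hF₀ hT 0]) 2 P
        = ENNReal.ofReal ‖powerSum (compression U K) n x‖ := fun n => by
    rw [shiftFiltration_zero, partialSum_iter, ofReal_norm,
      enorm_powerSum_compression_koopman hTP hF₀ hT hxK hxX₀]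
  have hb_succ := fun n => hb.pos (n + 1) (Nat.le_add_left 1 n)
  have hrate := hb.summable_norm_powerSum_sub_innovationSeries U hK hxK
    (hslow.summable_div_rpow (hb_succ 0) (fun n => norm_nonneg _) hnorm)
    (hslow.summable_mul_sq_powerTail hb_succ (fun n => norm_nonneg _) hnorm)
  obtain ⟨g, hg, hdg, hg_zero⟩ := exists_of_mem_innovationSpace_koopman hTP hF₀
    (innovationSeries_mem_innovationSpace U hK hxK)
  have hgT : Measurable (g ∘ T) := ((hg.mono hF₀).comp_measurable T.measurable).measurable
  have hgT_memLp : MemLp (g ∘ T) 2 P := (memLp_congr_ae hdg).1 (Lp.memLp _)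
  have hremainder : (x - innovationSeries U K x : Lp ℝ 2 P) =ᵐ[P] X₀ - g ∘ T :=
    (Lp.coeFn_sub _ _).trans (hxX₀.sub hdg)
  refine ⟨g, hg, hgT_memLp, hg_zero, ae_birkhoffSum_isLittleO_sqrt hTP
    ((hX₀.mono hF₀ le_rfl).sub hgT) (hX₀_memLp.sub hgT_memLp) hb.dyadicWeights_pos
    hb.summable_inv_dyadicWeights (hrate.congr fun J => ?_)⟩
  rw [norm_sq_eq_integral_of_ae_eq (coeFn_powerSum_koopman hTP hremainder (2 ^ J))]
  simp only [Real.norm_eq_abs, sq_abs]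

theorem isASMartingaleApprox_iter (hTP : MeasurePreserving T P P) (hF₀ : F₀ ≤ mΩ)
    (hT : F₀ ≤ F₀.comap T) {X₀ g : Ω → ℝ} (hg : StronglyMeasurable[F₀] g)
    (hg_memLp : MemLp (g ∘ T) 2 P) (hg_zero : P[g ∘ T | F₀] =ᵐ[P] 0)
    (hlittleO : ∀ᵐ ω ∂P,
      (fun n => birkhoffSum T (X₀ - g ∘ T) n ω) =o[atTop] fun n : ℕ => √(n : ℝ)) :
    IsASMartingaleApprox P (shiftFiltration F₀ T hF₀ hT)
      (fun i ω => X₀ (iter T i ω)) (fun k ω => (g ∘ T) (iter T k ω)) := by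
  have hgT : Measurable (g ∘ T) := ((hg.mono hF₀).comp_measurable T.measurable).measurable
  have hmemLp : ∀ k : ℤ, MemLp (fun ω => (g ∘ T) (iter T k ω)) 2 P := fun k =>
    hg_memLp.comp_measurePreserving (measurePreserving_iter hTP k)
  have hadapted : ∀ k : ℤ, StronglyMeasurable[shiftFiltration F₀ T hF₀ hT (k + 1)]
      (fun ω => (g ∘ T) (iter T k ω)) := fun k => by
    change StronglyMeasurable[F₀.comap (iter T (k + 1))] (g ∘ (T ∘ iter T k))
    rw [← iter_add_one]
    exact hg.comp_measurable (comap_measurable _)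
  have hzero : ∀ k : ℤ, P[fun ω => (g ∘ T) (iter T k ω) | shiftFiltration F₀ T hF₀ hT k]
      =ᵐ[P] 0 := fun k =>
    (condExp_comp_measurePreserving (measurePreserving_iter hTP k) hF₀
      (hg_memLp.integrable one_le_two)).trans
      ((measurePreserving_iter hTP k).quasiMeasurePreserving.ae_eq_comp hg_zero)
  refine ⟨isStationary_iter hTP hgT, hmemLp, hadapted, hzero,
    martingale_partialSum (fun k => (hmemLp k).integrable one_le_two) hadapted hzero, ?_⟩
  filter_upwards [hlittleO] with ω hω
  refine hω.tendsto_div_nhds_zero.congr fun n => ?_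
  rw [partialSum_iter, partialSum_iter]
  simp only [birkhoffSum, Pi.sub_apply, Finset.sum_sub_distrib]

theorem exists_isASMartingaleApprox_iter {b : ℕ → ℝ} (hb : AdmissibleWeights b)
    (hTP : MeasurePreserving T P P) (hF₀ : F₀ ≤ mΩ) (hT : F₀ ≤ F₀.comap T) {X₀ : Ω → ℝ}
    (hX₀ : Measurable[F₀] X₀) (hX₀_memLp : MemLp X₀ 2 P)
    (hslow : SlowCondition P (shiftFiltration F₀ T hF₀ hT) (fun i ω => X₀ (iter T i ω)) b) :
    ∃ D₀ : Ω → ℝ, IsASMartingaleApprox P (shiftFiltration F₀ T hF₀ hT)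
      (fun i ω => X₀ (iter T i ω)) (fun k ω => D₀ (iter T k ω)) := by
  obtain ⟨g, hg, hg_memLp, hg_zero, hlittleO⟩ :=
    exists_birkhoffSum_sub_isLittleO_sqrt hb hTP hF₀ hT hX₀ hX₀_memLp hslow
  exact ⟨g ∘ T, isASMartingaleApprox_iter hTP hF₀ hT hg hg_memLp hg_zero hlittleO⟩

end Transformation

section Factor

theorem partialSum_ae_eq_comp {Ω Ω' : Type*} [MeasurableSpace Ω] {P : Measure Ω} {φ : Ω → Ω'}
    {X : ℤ → Ω → ℝ} {X' : ℤ → Ω' → ℝ} (hX : ∀ k, X k =ᵐ[P] X' k ∘ φ) (n : ℕ) :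
    partialSum X n =ᵐ[P] partialSum X' n ∘ φ := by
  filter_upwards [ae_all_iff.2 hX] with ω hω
  simp only [partialSum, hω, Function.comp]

variable {Ω Ω' : Type*} [mΩ : MeasurableSpace Ω] [mΩ' : MeasurableSpace Ω'] {P : Measure Ω}
  {P' : Measure Ω'} {φ : Ω → Ω'} {F : Filtration ℤ mΩ} {F' : Filtration ℤ mΩ'}
  {X : ℤ → Ω → ℝ} {X' D' : ℤ → Ω' → ℝ}

theorem IsStationary.comp_measurePreserving {S : Type*} [MeasurableSpace S] {ξ : ℤ → Ω' → S}
    (h : IsStationary ξ P') (hφ : MeasurePreserving φ P P') :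
    IsStationary (fun k ω => ξ k (φ ω)) P := by
  intro k
  have hshifted := (h k).aemeasurable_fst
  have hprocess := (h k).aemeasurable_snd
  have hmap := (h k).map_eq
  rw [← hφ.map_eq] at hshifted hprocess
  rw [← hφ.map_eq, AEMeasurable.map_map_of_aemeasurable hshifted hφ.aemeasurable,
    AEMeasurable.map_map_of_aemeasurable hprocess hφ.aemeasurable] at hmap
  exact ⟨hshifted.comp_aemeasurable hφ.aemeasurable, hprocess.comp_aemeasurable hφ.aemeasurable,
    hmap⟩

theorem IsASMartingaleApprox.comp_measurePreserving [IsFiniteMeasure P]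
    (h : IsASMartingaleApprox P' F' X' D') (hφ : MeasurePreserving φ P P')
    (hF : ∀ k, (F' k).comap φ = F k) (hX : ∀ k, X k =ᵐ[P] X' k ∘ φ) :
    IsASMartingaleApprox P F X (fun k ω => D' k (φ ω)) := by
  have : IsFiniteMeasure P' := hφ.map_eq ▸ inferInstance
  have hmemLp : ∀ k : ℤ, MemLp (fun ω => D' k (φ ω)) 2 P := fun k =>
    (h.memLp k).comp_measurePreserving hφ
  have hadapted : ∀ k : ℤ, StronglyMeasurable[F (k + 1)] (fun ω => D' k (φ ω)) := fun k => by
    rw [← hF]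
    exact (h.adapted k).comp_measurable (comap_measurable φ)
  have hzero : ∀ k : ℤ, P[fun ω => D' k (φ ω) | F k] =ᵐ[P] 0 := fun k => by
    rw [← hF]
    exact (condExp_comp_measurePreserving hφ (F'.le k) ((h.memLp k).integrable one_le_two)).trans
      (hφ.quasiMeasurePreserving.ae_eq_comp (h.condExp_eq_zero k))
  refine ⟨h.stationary.comp_measurePreserving hφ, hmemLp, hadapted, hzero,
    martingale_partialSum (fun k => (hmemLp k).integrable one_le_two) hadapted hzero, ?_⟩
  filter_upwards [ae_all_iff.2 (partialSum_ae_eq_comp hX),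
    hφ.quasiMeasurePreserving.ae h.tendsto] with ω hsum htendsto
  refine htendsto.congr fun n => ?_
  rw [hsum]
  rfl

theorem SlowCondition.of_comp_measurePreserving [IsFiniteMeasure P] {b : ℕ → ℝ}
    (h : SlowCondition P F X b) (hφ : MeasurePreserving φ P P') (hF : (F' 0).comap φ = F 0)
    (hX : ∀ k, X k =ᵐ[P] X' k ∘ φ) (hX' : ∀ k, Integrable (X' k) P') :
    SlowCondition P' F' X' b := by
  have hnorm : ∀ n, eLpNorm (P'[partialSum X' n | F' 0]) 2 P'
      = eLpNorm (P[partialSum X n | F 0]) 2 P := by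
    intro n
    have hint : Integrable (partialSum X' n) P' := integrable_finsetSum _ fun i _ => hX' i
    rw [← eLpNorm_comp_measurePreserving integrable_condExp.aestronglyMeasurable hφ, ← hF]
    exact eLpNorm_congr_ae ((condExp_congr_ae (partialSum_ae_eq_comp hX n)).trans
      (condExp_comp_measurePreserving hφ (F'.le 0) hint)).symm
  unfold SlowCondition projTail
  simp only [hnorm]
  exact h

end Factor

section PathSpace

variable {Ω S : Type*} [mΩ : MeasurableSpace Ω] [mS : MeasurableSpace S]

/-- The left shift on two-sided sequences. -/
def shiftEquiv (S : Type*) [MeasurableSpace S] : (ℤ → S) ≃ᵐ (ℤ → S) where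
  toFun x i := x (i + 1)
  invFun x i := x (i - 1)
  left_inv x := by funext i; simp
  right_inv x := by funext i; simp
  measurable_toFun := measurable_pi_lambda _ fun i => measurable_pi_apply (i + 1)
  measurable_invFun := measurable_pi_lambda _ fun i => measurable_pi_apply (i - 1)

theorem shiftEquiv_apply (x : ℤ → S) (i : ℤ) : shiftEquiv S x i = x (i + 1) := rfl

theorem shiftEquiv_symm_apply (x : ℤ → S) (i : ℤ) : (shiftEquiv S).symm x i = x (i - 1) := rfl

theorem iter_shiftEquiv_apply (k : ℤ) (x : ℤ → S) (i : ℤ) :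
    iter (shiftEquiv S) k x i = x (i + k) := by
  induction k using Int.induction_on generalizing i with
  | zero => rw [iter_zero, id, add_zero]
  | succ n ih => rw [iter_add_one, Function.comp_apply, shiftEquiv_apply, ih, add_right_comm,
      add_assoc]
  | pred n ih => rw [iter_sub_one, Function.comp_apply, shiftEquiv_symm_apply, ih, sub_add_comm,
      add_comm, ← add_sub_assoc, add_sub_assoc]

/-- The `σ`-algebra on two-sided sequences generated by the coordinates at times `i ≤ 0`. -/
@[reducible] def pathPast (S : Type*) [mS : MeasurableSpace S] : MeasurableSpace (ℤ → S) :=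
  ⨆ (i : ℤ) (_ : i ≤ 0), mS.comap fun x => x i

theorem pathPast_le : pathPast S ≤ MeasurableSpace.pi :=
  iSup₂_le fun i _ => (measurable_pi_apply i).comap_le

theorem measurable_pathPast_apply_zero : Measurable[pathPast S] fun x : ℤ → S => x 0 :=
  measurable_iff_comap_le.2
    (le_iSup₂ (f := fun (i : ℤ) (_ : i ≤ 0) => mS.comap fun x : ℤ → S => x i) 0 le_rfl)

theorem comap_pathPast {α : Type*} (φ : α → ℤ → S) :
    (pathPast S).comap φ = ⨆ (i : ℤ) (_ : i ≤ 0), mS.comap fun ω => φ ω i := by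
  simp only [pathPast, MeasurableSpace.comap_iSup, MeasurableSpace.comap_comp]
  rfl

theorem pathPast_le_comap : pathPast S ≤ (pathPast S).comap (shiftEquiv S) := by
  rw [comap_pathPast]
  refine iSup₂_le fun i hi => le_trans (le_of_eq ?_) (le_iSup₂ (i - 1) (by lia))
  simp only [shiftEquiv_apply, sub_add_cancel]

theorem comap_shiftFiltration_pathPast (ξ : ℤ → Ω → S) (hξ : ∀ i, Measurable (ξ i)) (k : ℤ) :
    (shiftFiltration (pathPast S) (shiftEquiv S) pathPast_le pathPast_le_comap k).comap
      (fun ω i => ξ i ω) = pastFiltration ξ hξ k := by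
  change ((pathPast S).comap (iter (shiftEquiv S) k)).comap _
    = ⨆ (i : ℤ) (_ : i ≤ k), mS.comap (ξ i)
  rw [MeasurableSpace.comap_comp, comap_pathPast]
  simp only [Function.comp, iter_shiftEquiv_apply]
  refine le_antisymm (iSup₂_le fun i hi => ?_) (iSup₂_le fun i hi => ?_)
  · exact le_iSup₂ (f := fun (i : ℤ) (_ : i ≤ k) => mS.comap (ξ i)) (i + k) (by lia)
  · refine le_trans (le_of_eq ?_) (le_iSup₂ (i - k) (by lia))
    simp only [sub_add_cancel]

theorem IsStationary.measurePreserving_shiftEquiv {P : Measure Ω} {ξ : ℤ → Ω → S}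
    (h : IsStationary ξ P) (hξ : ∀ i, Measurable (ξ i)) :
    MeasurePreserving (shiftEquiv S) (P.map fun ω i => ξ i ω) (P.map fun ω i => ξ i ω) := by
  refine ⟨(shiftEquiv S).measurable, ?_⟩
  rw [Measure.map_map (shiftEquiv S).measurable (measurable_pi_lambda _ hξ)]
  exact (h 1).map_eq

theorem exists_isASMartingaleApprox_of_isStationary {b : ℕ → ℝ} (hb : AdmissibleWeights b)
    {P : Measure Ω} [IsProbabilityMeasure P] {ξ : ℤ → Ω → S} (hξ : ∀ i, Measurable (ξ i))
    (hstat : IsStationary ξ P) {f : S → ℝ} (hf : MemLp f 2 (P.map (ξ 0)))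
    (hslow : SlowCondition P (pastFiltration ξ hξ) (fun i ω => f (ξ i ω)) b) :
    ∃ D : ℤ → Ω → ℝ,
      IsASMartingaleApprox P (pastFiltration ξ hξ) (fun i ω => f (ξ i ω)) D := by
  set φ : Ω → ℤ → S := fun ω i => ξ i ω
  have hφ_meas : Measurable φ := measurable_pi_lambda _ hξ
  have hφ : MeasurePreserving φ P (P.map φ) := hφ_meas.measurePreserving P
  have : IsProbabilityMeasure (P.map φ) := Measure.isProbabilityMeasure_map hφ_meas.aemeasurable
  have hshift : MeasurePreserving (shiftEquiv S) (P.map φ) (P.map φ) :=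
    hstat.measurePreserving_shiftEquiv hξ
  have hiter := measurePreserving_iter hshift
  have hcoord : MeasurePreserving (fun x : ℤ → S => x 0) (P.map φ) (P.map (ξ 0)) :=
    ⟨measurable_pi_apply 0, Measure.map_map (measurable_pi_apply 0) hφ_meas⟩
  obtain ⟨g, hg, hfg⟩ := hf.1
  have hX₀ : Measurable[pathPast S] fun x : ℤ → S => g (x 0) :=
    hg.measurable.comp measurable_pathPast_apply_zero
  have hX₀_memLp : MemLp (fun x : ℤ → S => g (x 0)) 2 (P.map φ) :=
    ((memLp_congr_ae hfg).1 hf).comp_measurePreserving hcoord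
  have hfactor : ∀ k : ℤ, (fun ω => f (ξ k ω))
      =ᵐ[P] (fun x => g (iter (shiftEquiv S) k x 0)) ∘ φ := fun k => by
    filter_upwards [((hcoord.comp (hiter k)).comp hφ).quasiMeasurePreserving.ae_eq_comp hfg]
      with ω hω
    simpa only [Function.comp, iter_shiftEquiv_apply, zero_add] using hω
  have hslow_path := hslow.of_comp_measurePreserving hφ (comap_shiftFiltration_pathPast ξ hξ 0)
    hfactor fun k => (hX₀_memLp.comp_measurePreserving (hiter k)).integrable one_le_two
  obtain ⟨D₀, hD₀⟩ := exists_isASMartingaleApprox_iter hb hshift pathPast_le pathPast_le_comap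
    hX₀ hX₀_memLp hslow_path
  exact ⟨_, hD₀.comp_measurePreserving hφ (comap_shiftFiltration_pathPast ξ hξ) hfactor⟩

end PathSpace

end MartApprox

theorem mainTheorem3_general :
    (∀ b : ℕ → ℝ, MartApprox.AdmissibleWeights b →
      ∀ (Ω : Type*) (F₀ : MeasurableSpace Ω) [mΩ : MeasurableSpace Ω] (P : Measure Ω)
        [IsProbabilityMeasure P] (T : Ω ≃ᵐ Ω) (_ : MeasurePreserving T P P)
        (hF₀ : F₀ ≤ mΩ) (hT : F₀ ≤ F₀.comap T)
        (X₀ : Ω → ℝ) (_ : Measurable[F₀] X₀) (_ : MemLp X₀ 2 P),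
        MartApprox.SlowCondition P (MartApprox.shiftFiltration F₀ T hF₀ hT)
          (fun i ω => X₀ (MartApprox.iter T i ω)) b →
        ∃ D : ℤ → Ω → ℝ, (∀ (k : ℤ) (ω : Ω), D k ω = D 0 (MartApprox.iter T k ω)) ∧
          MartApprox.IsASMartingaleApprox P (MartApprox.shiftFiltration F₀ T hF₀ hT)
            (fun i ω => X₀ (MartApprox.iter T i ω)) D) ∧
    (∀ b : ℕ → ℝ, MartApprox.AdmissibleWeights b →
      ∀ (Ω S : Type*) [MeasurableSpace Ω] [MeasurableSpace S]
        (P : Measure Ω) [IsProbabilityMeasure P]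
        (ξ : ℤ → Ω → S) (hξ : ∀ i, Measurable (ξ i)) (_ : MartApprox.IsStationary ξ P)
        (f : S → ℝ) (_ : MemLp f 2 (P.map (ξ 0))),
        MartApprox.SlowCondition P (MartApprox.pastFiltration ξ hξ)
          (fun i ω => f (ξ i ω)) b →
        ∃ D : ℤ → Ω → ℝ,
          MartApprox.IsASMartingaleApprox P (MartApprox.pastFiltration ξ hξ)
            (fun i ω => f (ξ i ω)) D) ∧
    (∀ γ : ℝ, 1 < γ → MartApprox.AdmissibleWeights (MartApprox.logWeights γ)) := by
  refine ⟨fun b hb Ω F₀ mΩ P _ T hTP hF₀ hT X₀ hX₀ hX₀_memLp hslow => ?_,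
    fun b hb Ω S _ _ P _ ξ hξ hstat f hf hslow =>
      MartApprox.exists_isASMartingaleApprox_of_isStationary hb hξ hstat hf hslow,
    fun γ hγ => MartApprox.admissibleWeights_logWeights hγ⟩
  obtain ⟨D₀, hD₀⟩ :=
    MartApprox.exists_isASMartingaleApprox_iter hb hTP hF₀ hT hX₀ hX₀_memLp hslow
  refine ⟨_, fun k ω => ?_, hD₀⟩
  simp only [MartApprox.iter_zero, id]

theorem mainTheorem3 :
    -- sequences given by a measure preserving transformation: `X_i = X_0 ∘ T^i`
    (∀ b : ℕ → ℝ, MartApprox.AdmissibleWeights b →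
      ∀ (Ω : Type*) (F₀ : MeasurableSpace Ω) [mΩ : MeasurableSpace Ω] (P : Measure Ω) [IsProbabilityMeasure P]
        (T : Ω ≃ᵐ Ω) (_ : MeasurePreserving T P P)
        (hF₀ : F₀ ≤ mΩ) (hT : F₀ ≤ F₀.comap T)
        (X₀ : Ω → ℝ) (_ : Measurable[F₀] X₀) (_ : MemLp X₀ 2 P) (_ : ∫ ω, X₀ ω ∂P = 0),
        MartApprox.SlowCondition P (MartApprox.shiftFiltration F₀ T hF₀ hT)
          (fun i ω => X₀ (MartApprox.iter T i ω)) b →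
        ∃ D : ℤ → Ω → ℝ, (∀ (k : ℤ) (ω : Ω), D k ω = D 0 (MartApprox.iter T k ω)) ∧
          MartApprox.IsASMartingaleApprox P (MartApprox.shiftFiltration F₀ T hF₀ hT)
            (fun i ω => X₀ (MartApprox.iter T i ω)) D) ∧
    -- functions of a stationary Markov chain: `X_i = f(ξ_i)`
    (∀ b : ℕ → ℝ, MartApprox.AdmissibleWeights b →
      ∀ (Ω S : Type*) [MeasurableSpace Ω] [MeasurableSpace S]
        (P : Measure Ω) [IsProbabilityMeasure P]
        (ξ : ℤ → Ω → S) (hξ : ∀ i, Measurable (ξ i))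
        (_ : MartApprox.IsStationary ξ P) (_ : MartApprox.HasMarkovProperty ξ hξ P)
        (f : S → ℝ) (_ : MemLp f 2 (P.map (ξ 0))) (_ : ∫ x, f x ∂(P.map (ξ 0)) = 0),
        MartApprox.SlowCondition P (MartApprox.pastFiltration ξ hξ)
          (fun i ω => f (ξ i ω)) b →
        ∃ D : ℤ → Ω → ℝ,
          MartApprox.IsASMartingaleApprox P (MartApprox.pastFiltration ξ hξ)
            (fun i ω => f (ξ i ω)) D) ∧
    -- the example of admissible weights
    (∀ γ : ℝ, 1 < γ → MartApprox.AdmissibleWeights (MartApprox.logWeights γ)) := by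
  obtain ⟨htransformation, hprocess, hweights⟩ := mainTheorem3_general
  exact ⟨fun b hb Ω F₀ _ P _ T hTP hF₀ hT X₀ hX₀ hX₀_memLp _ =>
      htransformation b hb Ω F₀ P T hTP hF₀ hT X₀ hX₀ hX₀_memLp,
    fun b hb Ω S _ _ P _ ξ hξ hstat _ f hf _ => hprocess b hb Ω S P ξ hξ hstat f hf, hweights⟩
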